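/- Let $G$ be a nilpotent group of (invertible) measure preserving transformations of a probability space $(X,\mathcal X,\mu)$, where transformations that agree $\mu$-almost everywhere may be identified; a transformation $S\in G$ acts on functions by $(Sf)(x)=f(Sx)$. Let $d,l,r\ge 0$ be integers, let $T_1,\dots,T_l\in G$, let $f_1,\dots,f_r\in L^\infty(X,\mathcal X,\mu)$ be real or complex valued, and let $p_{i,j}:\mathbb Z^d\to\mathbb Z$ ($1\le i\le l$, $1\le j\le r$) be polynomials, that is, restrictions to $\mathbb Z^d$ of polynomials with real coefficients that take integer values on $\mathbb Z^d$. Let $(\Phi_N)_{N\ge 1}$ be a Følner sequence in $\mathbb Z^d$, that is, a sequence of finite subsets of $\mathbb Z^d$, nonempty for all large $N$, such that $|(v+\Phi_N)\,\triangle\,\Phi_N|/|\Phi_N|\to 0$ as $N\to\infty$ for every $v\in\mathbb Z^d$. Then the averages $$\frac{1}{|\Phi_N|}\sum_{u\in\Phi_N}\prod_{j=1}^{r}\left(T_1^{p_{1,j}(u)}\cdots T_l^{p_{l,j}(u)}\right)f_j$$ converge in $L^2(X,\mathcal X,\mu)$ as $N\to\infty$. -/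

import Mathlib

open MeasureTheory Filter Topology

/-- A map `p : ℤ^d → ℤ` is a polynomial (an integer valued polynomial in `d` variables): it is the
restriction to `ℤ^d` of a polynomial with real coefficients. The coefficients need not be
integers, so that for instance `n ↦ n (n - 1) / 2` is allowed. -/
def IsIntValuedPolynomial {d : ℕ} (p : (Fin d → ℤ) → ℤ) : Prop :=
  ∃ P : MvPolynomial (Fin d) ℝ, ∀ u : Fin d → ℤ,
    (p u : ℝ) = MvPolynomial.eval (fun i => (u i : ℝ)) P

/-- A group `G` of (invertible) measure preserving transformations of `(X, μ)`, presented by the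
map `ρ` sending `g : G` to the transformation `x ↦ ρ g x`. As usual in measure theory,
transformations that agree almost everywhere are not distinguished, so that the group laws are
only required to hold almost everywhere; a genuine action of `G` on `X` by measure preserving maps
is a special case. -/
structure IsMeasurePreservingAction {G X : Type*} [Group G] [MeasurableSpace X]
    (ρ : G → X → X) (μ : Measure X) : Prop where
  measurePreserving : ∀ g : G, MeasurePreserving (ρ g) μ μ
  one_ae : ∀ᵐ x ∂μ, ρ 1 x = x
  mul_ae : ∀ g h : G, ∀ᵐ x ∂μ, ρ (g * h) x = ρ g (ρ h x)

/-- The product `T₁ ^ n₁ ⋯ T_l ^ n_l`, in this order. -/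
def orderedZPowProd {G : Type*} [Group G] {l : ℕ} (T : Fin l → G) (n : Fin l → ℤ) : G :=
  (List.ofFn fun i => T i ^ n i).prod

/-- The average over the finite set `Φ ⊆ ℤ^d` of
`∏_j (T₁ ^ p_{1,j}(u) ⋯ T_l ^ p_{l,j}(u)) f_j`, where a transformation `S` acts on functions by
`(S f)(x) = f (S x)`. -/
noncomputable def polynomialAverage {G X 𝕜 : Type*} [Group G] [RCLike 𝕜] {d l r : ℕ}
    (ρ : G → X → X) (T : Fin l → G) (p : Fin l → Fin r → (Fin d → ℤ) → ℤ)
    (f : Fin r → X → 𝕜) (Φ : Finset (Fin d → ℤ)) (x : X) : 𝕜 :=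
  (Φ.card : 𝕜)⁻¹ * ∑ u ∈ Φ, ∏ j, f j (ρ (orderedZPowProd T fun i => p i j u) x)

/-!
# Norm convergence of polynomial averages in a nilpotent group

The proof follows Walsh's argument, with an ultraproduct instead of explicit bounds.

Let `g₁, …, g_r, g₀` be sequences in the group. To see that the averages of
`∏ g_i(n) f_i · g₀(n) F` converge, the bounded function `F` is split into a function whose averages
converge and a function `e` nearly orthogonal to all functions of that kind
(`exists_almost_orthogonal`). If the averages of `e` did not become small, then some average `h`
over a long set `Φ_K` would be large, and `e` would correlate with the dual function
`σ = avg_{n ∈ Φ_K} g₀(n)⁻¹ (h · ∏ star (g_i(n) f_i))`. Translating `n = l + m` in `g₀(l) σ` shows that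
the averages of `σ` are means over `m` of averages along the `g_i` and the sequences
`⟨g₀ | g_i⟩_m (l) = g₀(l) g₀(l + m)⁻¹ g_i(l + m)`. If these converge, then `σ` is of the first kind,
which contradicts the near orthogonality (`isAsympCauchy_weightedAvg`). So convergence for a system
follows from convergence for its reduction.

The averages of the reduction have to converge uniformly in `m` and in the length of `Φ_K`, in a
weak sense. Therefore sequences and functions are indexed from the start by `ℕ × W`, where `W`
collects the shifts `m` met so far, convergence is measured in mean square over finite subsets of
`W`, and "up to an error" means for almost all `k : ℕ` with respect to a fixed ultrafilter. A long
set `Φ_K` is obtained by countable saturation (`exists_tendsto_of_frequently`).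

That finitely many reductions lead to the trivial system is a statement about groups. The sequences
`n ↦ x ^ p(n)` with `p` of bounded degree generate a nilpotent group, on whose abelianization the
translations act unipotently, since differences lower the degree of `p`. A Leibniz rule for
commutators makes them unipotent on the whole group (`unipotent_of_unipotent_abelianization`): there
is a finite chain of normal subgroups such that translations are trivial on each one modulo the
next. The reduction by `g₀` preserves the cosets `y Q` with `y ∈ g₀ P`, for `Q` next to `P` in this
chain, so that the cosets of a system can be removed one at a time
(`IsReductionStable.good_union_coset`).

The functions enter through the algebra of multiplication operators on `L²`, on which the group acts
by conjugation with Koopman operators (`cauchySeq_operators`).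
-/

open scoped commutatorElement

set_option linter.unusedSectionVars false

/-! ### Functions killed by iterated differences -/

/-- `VanishingDiff e f` says that all `e`-fold iterated differences of `f` vanish, so that `f` is a
polynomial map of degree less than `e`. -/
def VanishingDiff {V M : Type*} [Add V] [AddCommGroup M] : ℕ → (V → M) → Prop
  | 0, f => ∀ n, f n = 0
  | e + 1, f => ∀ m, VanishingDiff e fun n => f n - f (n + m)

namespace VanishingDiff

variable {V M : Type*} [AddCommGroup V] [AddCommGroup M]

theorem zero (e : ℕ) : VanishingDiff e (fun _ : V => (0 : M)) := by
  induction e with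
  | zero => exact fun _ => rfl
  | succ e ih => intro m; simpa using ih

theorem succ {e : ℕ} {f : V → M} (h : VanishingDiff e f) : VanishingDiff (e + 1) f := by
  induction e generalizing f with
  | zero => intro m n; simp [h n, h (n + m)]
  | succ e ih => exact fun m => ih (h m)

theorem mono {a b : ℕ} (hab : a ≤ b) {f : V → M} (h : VanishingDiff a f) : VanishingDiff b f := by
  induction hab with
  | refl => exact h
  | step _ ih => exact ih.succ

theorem add {e : ℕ} {f g : V → M} (hf : VanishingDiff e f) (hg : VanishingDiff e g) :
    VanishingDiff e fun n => f n + g n := by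
  induction e generalizing f g with
  | zero => intro n; simp [hf n, hg n]
  | succ e ih =>
    intro m
    have h := ih (hf m) (hg m)
    have e1 : (fun n => f n + g n - (f (n + m) + g (n + m))) =
        fun n => f n - f (n + m) + (g n - g (n + m)) := by funext n; abel
    rw [e1]; exact h

theorem shift {e : ℕ} {f : V → M} (hf : VanishingDiff e f) (v : V) :
    VanishingDiff e fun n => f (n + v) := by
  induction e generalizing f with
  | zero => exact fun n => hf _
  | succ e ih =>
    intro m
    have h := ih (hf m)
    simpa only [add_right_comm] using h

theorem mul {R : Type*} [CommRing R] {a b : ℕ} {f g : V → R} (hf : VanishingDiff a f)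
    (hg : VanishingDiff b g) : VanishingDiff (a + b) fun n => f n * g n := by
  induction hk : a + b generalizing a b f g with
  | zero =>
    obtain rfl : a = 0 := by omega
    intro n; simp [hf n]
  | succ k ih =>
    rcases a with _ | a
    · have : (fun n => f n * g n) = fun _ => 0 := by funext n; simp [hf n]
      rw [this]; exact zero _
    rcases b with _ | b
    · have : (fun n => f n * g n) = fun _ => 0 := by funext n; simp [hg n]
      rw [this]; exact zero _
    intro m
    have e1 : (fun n => f n * g n - f (n + m) * g (n + m)) =
        fun n => (f n - f (n + m)) * g n + f (n + m) * (g n - g (n + m)) := by funext n; ring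
    rw [e1]
    exact add (ih (hf m) hg (by omega)) (ih (hf.shift m) (hg m) (by omega))

theorem of_intCast {e : ℕ} {p : V → ℤ} (h : VanishingDiff e fun n => (p n : ℝ)) :
    VanishingDiff e p := by
  induction e generalizing p with
  | zero => exact fun n => Int.cast_eq_zero.1 (h n)
  | succ e ih => exact fun m => ih (by simpa using h m)

end VanishingDiff

theorem IsIntValuedPolynomial.exists_vanishingDiff {d : ℕ} {p : (Fin d → ℤ) → ℤ}
    (hp : IsIntValuedPolynomial p) : ∃ e, VanishingDiff e p := by
  obtain ⟨P, hP⟩ := hp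
  have key : ∃ e, VanishingDiff e fun u : Fin d → ℤ =>
      MvPolynomial.eval (fun i => (u i : ℝ)) P := by
    clear hP
    induction P using MvPolynomial.induction_on with
    | C a => exact ⟨1, fun m n => by simp⟩
    | add P Q hP hQ =>
      obtain ⟨a, ha⟩ := hP
      obtain ⟨b, hb⟩ := hQ
      refine ⟨max a b, ?_⟩
      simpa using (ha.mono (le_max_left a b)).add (hb.mono (le_max_right a b))
    | mul_X P i hP =>
      obtain ⟨a, ha⟩ := hP
      have hX : VanishingDiff 2 fun u : Fin d → ℤ => (u i : ℝ) := by
        intro m m' n; simp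
      exact ⟨a + 2, by simpa using ha.mul hX⟩
  obtain ⟨e, he⟩ := key
  exact ⟨e, .of_intCast (by simpa only [hP] using he)⟩

/-! ### Unipotent chains of normal subgroups -/

/-- One step of a chain of normal subgroups on which a family `τ` of endomorphisms acts
unipotently: `Y ≤ X`, both are normal, `Y` is stable under every `τ m`, and `τ m` is the identity on
`X` modulo `Y`. -/
structure UnipotentStep {V Γ : Type*} [Group Γ] (τ : V → Γ →* Γ) (X Y : Subgroup Γ) : Prop where
  normal_left : X.Normal
  normal_right : Y.Normal
  le : Y ≤ X
  map_mem : ∀ m, ∀ y ∈ Y, τ m y ∈ Y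
  diff_mem : ∀ m, ∀ x ∈ X, x * (τ m x)⁻¹ ∈ Y

section Chains

variable {V Γ : Type*} [Group Γ] {τ : V → Γ →* Γ}

/-- The elements that every `τ m` fixes modulo the normal subgroup `M`. -/
def fixedModulo (τ : V → Γ →* Γ) (M : Subgroup Γ) [M.Normal] : Subgroup Γ where
  carrier := {z | ∀ m, z * (τ m z)⁻¹ ∈ M}
  one_mem' := fun m => by simp [M.one_mem]
  mul_mem' := by
    intro a b ha hb m
    have h := M.mul_mem (Subgroup.Normal.conj_mem inferInstance _ (hb m) a) (ha m)
    simpa [mul_assoc] using h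
  inv_mem' := by
    intro a ha m
    have h := M.inv_mem (Subgroup.Normal.conj_mem inferInstance _ (ha m) a⁻¹)
    simpa [mul_assoc] using h

theorem UnipotentStep.left_map_mem {X Y : Subgroup Γ} (h : UnipotentStep τ X Y) (m : V) {x : Γ}
    (hx : x ∈ X) : τ m x ∈ X := by
  have h1 := X.mul_mem (X.inv_mem (h.le (h.diff_mem m x hx))) hx
  simpa using h1

theorem map_mem_commutator {A B : Subgroup Γ} (m : V) (hA : ∀ a ∈ A, τ m a ∈ A)
    (hB : ∀ b ∈ B, τ m b ∈ B) : ∀ z ∈ ⁅A, B⁆, τ m z ∈ ⁅A, B⁆ := by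
  have : ⁅A, B⁆ ≤ ⁅A, B⁆.comap (τ m) := by
    rw [Subgroup.commutator_le]
    intro a ha b hb
    rw [Subgroup.mem_comap, map_commutatorElement]
    exact Subgroup.commutator_mem_commutator (hA a ha) (hB b hb)
  exact this

theorem map_mem_sup {A B : Subgroup Γ} (m : V) (hA : ∀ a ∈ A, τ m a ∈ A)
    (hB : ∀ b ∈ B, τ m b ∈ B) : ∀ z ∈ A ⊔ B, τ m z ∈ A ⊔ B := by
  have : A ⊔ B ≤ (A ⊔ B).comap (τ m) :=
    sup_le (fun a ha => (le_sup_left : A ≤ A ⊔ B) (hA a ha))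
      (fun b hb => (le_sup_right : B ≤ A ⊔ B) (hB b hb))
  exact this

/-- Leibniz rule: modulo `E ⊇ ⁅Y, ⊤⁆`, a unipotent step from `A` to `B` gives one from `⁅X, A⁆` to
`⁅X, B⁆`, when `τ` is trivial on `X` modulo `Y`. -/
theorem UnipotentStep.commutator {X Y A B E : Subgroup Γ} (hXY : UnipotentStep τ X Y)
    (hAB : UnipotentStep τ A B) [hE : E.Normal] (hEτ : ∀ m, ∀ z ∈ E, τ m z ∈ E)
    (hYE : ⁅Y, (⊤ : Subgroup Γ)⁆ ≤ E) : UnipotentStep τ (⁅X, A⁆ ⊔ E) (⁅X, B⁆ ⊔ E) := by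
  have := hXY.normal_left
  have := hXY.normal_right
  have := hAB.normal_left
  have := hAB.normal_right
  refine ⟨inferInstance, inferInstance,
    sup_le_sup_right (Subgroup.commutator_mono le_rfl hAB.le) _, fun m => map_mem_sup m
      (map_mem_commutator m (fun x hx => hXY.left_map_mem m hx) (hAB.map_mem m)) (hEτ m), ?_⟩
  set M := ⁅X, B⁆ ⊔ E with hM
  have hMn : M.Normal := inferInstance
  suffices h : ⁅X, A⁆ ⊔ E ≤ fixedModulo τ M from fun m x hx => h hx m
  refine sup_le ?_ fun z hz m =>
    (le_sup_right : E ≤ M) (E.mul_mem hz (E.inv_mem (hEτ m z hz)))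
  rw [Subgroup.commutator_le]
  intro x hx a ha m
  -- In `Γ ⧸ M` the class of `y = x (τ x)⁻¹` is central, and that of `b = a (τ a)⁻¹` commutes
  -- with the classes of `X`.
  obtain ⟨y, hy, hxy⟩ : ∃ y ∈ Y, τ m x = y⁻¹ * x :=
    ⟨_, hXY.diff_mem m x hx, by simp⟩
  obtain ⟨b, hb, hab⟩ : ∃ b ∈ B, τ m a = b⁻¹ * a :=
    ⟨_, hAB.diff_mem m a ha, by simp⟩
  let π := QuotientGroup.mk' M
  have hcomm : ∀ {u v : Γ}, ⁅u, v⁆ ∈ M → Commute (π u) (π v) := by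
    intro u v huv
    rw [← commutatorElement_eq_one_iff_commute, ← map_commutatorElement]
    exact (QuotientGroup.eq_one_iff _).2 huv
  have hyc : ∀ g, Commute (π y) (π g) := fun g => hcomm
    ((le_sup_right : E ≤ M) (hYE (Subgroup.commutator_mem_commutator hy (Subgroup.mem_top g))))
  have hbc : ∀ g ∈ X, Commute (π g) (π b) := fun g hg => hcomm
    ((le_sup_left : ⁅X, B⁆ ≤ M) (Subgroup.commutator_mem_commutator hg hb))
  have hxa : Commute (π ⁅x, a⁆) (π b) :=
    hbc _ (Subgroup.commutator_le_left X A (Subgroup.commutator_mem_commutator hx ha))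
  have hxb := hbc x hx
  have hya := hyc (b⁻¹ * a)
  have key : π (τ m ⁅x, a⁆) = π ⁅x, a⁆ := by
    have h1 : π (τ m ⁅x, a⁆) = ⁅π x, π (b⁻¹ * a)⁆ := by
      rw [map_commutatorElement, map_commutatorElement, hxy, hab, map_mul π y⁻¹ x,
        map_inv, commutatorElement_def, commutatorElement_def]
      have e1 : (π y)⁻¹ * π x * π (b⁻¹ * a) * ((π y)⁻¹ * π x)⁻¹ =
          (π y)⁻¹ * (π x * π (b⁻¹ * a) * (π x)⁻¹) * π y := by group
      have e2 : Commute (π y) (π x * π (b⁻¹ * a) * (π x)⁻¹) := by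
        have := hyc (x * (b⁻¹ * a) * x⁻¹)
        simpa using this
      rw [e1, mul_assoc (π y)⁻¹, ← e2.eq, inv_mul_cancel_left]
    have h2 : ⁅π x, π (b⁻¹ * a)⁆ = (π b)⁻¹ * π ⁅x, a⁆ * π b := by
      rw [map_mul, map_inv, map_commutatorElement, commutatorElement_def, commutatorElement_def]
      have e1 : π x * (π b)⁻¹ = (π b)⁻¹ * π x := hxb.inv_right.eq
      rw [← mul_assoc (π x), e1]; group
    rw [h1, h2, mul_assoc, hxa.eq, ← mul_assoc, inv_mul_cancel, one_mul]
  rw [← QuotientGroup.eq_one_iff]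
  change π (⁅x, a⁆ * (τ m ⁅x, a⁆)⁻¹) = 1
  rw [map_mul, map_inv, key, mul_inv_cancel]

/-- A case of the three subgroups lemma. -/
theorem commutator_commutator_top_le (X : Subgroup Γ) [X.Normal] :
    ⁅X, ⁅(⊤ : Subgroup Γ), ⊤⁆⁆ ≤ ⁅⁅X, (⊤ : Subgroup Γ)⁆, (⊤ : Subgroup Γ)⁆ := by
  set M := ⁅⁅X, (⊤ : Subgroup Γ)⁆, (⊤ : Subgroup Γ)⁆ with hM
  have hMn : M.Normal := inferInstance
  have hker : (QuotientGroup.mk' M).ker = M := QuotientGroup.ker_mk' M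
  have htop : (⊤ : Subgroup Γ).map (QuotientGroup.mk' M) = (⊤ : Subgroup (Γ ⧸ M)) :=
    Subgroup.map_top_of_surjective (QuotientGroup.mk' M) (QuotientGroup.mk'_surjective M)
  have h1 : ⁅⁅X.map (QuotientGroup.mk' M), (⊤ : Subgroup (Γ ⧸ M))⁆, (⊤ : Subgroup (Γ ⧸ M))⁆ = ⊥ := by
    rw [← htop, ← Subgroup.map_commutator, ← Subgroup.map_commutator,
      Subgroup.map_eq_bot_iff, hker]
  have h2 : ⁅⁅(⊤ : Subgroup (Γ ⧸ M)), (⊤ : Subgroup (Γ ⧸ M))⁆, X.map (QuotientGroup.mk' M)⁆ =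
      (⊥ : Subgroup (Γ ⧸ M)) := by
    apply Subgroup.commutator_commutator_eq_bot_of_rotate
    · rw [Subgroup.commutator_comm (⊤ : Subgroup (Γ ⧸ M)) (X.map (QuotientGroup.mk' M))]; exact h1
    · exact h1
  rw [← hker, ← Subgroup.map_eq_bot_iff, Subgroup.map_commutator, Subgroup.map_commutator, htop,
    Subgroup.commutator_comm, h2]

open Relation

theorem UnipotentStep.chain_le {X Y : Subgroup Γ}
    (h : ReflTransGen (UnipotentStep τ) X Y) : Y ≤ X := by
  induction h with
  | refl => exact le_rfl
  | tail _ h ih => exact h.le.trans ih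

/-- If `τ` is unipotent on the abelianization, a chain from `X` to `Y` induces one from `⁅X, ⊤⁆` to
`⁅Y, ⊤⁆`, modulo any `C` that contains `⁅X, ⁅⊤, ⊤⁆⁆`. -/
theorem chain_commutator_top
    (hab : ReflTransGen (UnipotentStep τ) ⊤ ⁅(⊤ : Subgroup Γ), ⊤⁆) {X Y C : Subgroup Γ}
    (h : ReflTransGen (UnipotentStep τ) X Y) [hC : C.Normal] (hCτ : ∀ m, ∀ z ∈ C, τ m z ∈ C)
    (hXC : ⁅X, ⁅(⊤ : Subgroup Γ), ⊤⁆⁆ ≤ C) :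
    ReflTransGen (UnipotentStep τ) (⁅X, ⊤⁆ ⊔ C) (⁅Y, ⊤⁆ ⊔ C) := by
  induction h with
  | refl => exact .refl
  | @tail Z Y hXZ hZY ih =>
    refine ih.trans ?_
    have := hZY.normal_right
    have hEτ : ∀ m, ∀ z ∈ ⁅Y, (⊤ : Subgroup Γ)⁆ ⊔ C, τ m z ∈ ⁅Y, (⊤ : Subgroup Γ)⁆ ⊔ C :=
      fun m => map_mem_sup m
        (map_mem_commutator m (hZY.map_mem m) fun _ _ => Subgroup.mem_top _) (hCτ m)
    have h1 : ReflTransGen (UnipotentStep τ) (⁅Z, (⊤ : Subgroup Γ)⁆ ⊔ (⁅Y, (⊤ : Subgroup Γ)⁆ ⊔ C))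
        (⁅Z, ⁅(⊤ : Subgroup Γ), ⊤⁆⁆ ⊔ (⁅Y, (⊤ : Subgroup Γ)⁆ ⊔ C)) :=
      hab.lift (fun A => ⁅Z, A⁆ ⊔ (⁅Y, (⊤ : Subgroup Γ)⁆ ⊔ C)) fun A B hAB =>
        hZY.commutator hAB hEτ le_sup_left
    have e1 : ⁅Z, (⊤ : Subgroup Γ)⁆ ⊔ (⁅Y, (⊤ : Subgroup Γ)⁆ ⊔ C) = ⁅Z, ⊤⁆ ⊔ C := by
      rw [← sup_assoc, sup_eq_left.2 (Subgroup.commutator_mono hZY.le le_rfl)]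
    have e2 : ⁅Z, ⁅(⊤ : Subgroup Γ), ⊤⁆⁆ ⊔ (⁅Y, (⊤ : Subgroup Γ)⁆ ⊔ C) = ⁅Y, ⊤⁆ ⊔ C :=
      sup_eq_right.2 (((Subgroup.commutator_mono (UnipotentStep.chain_le hXZ) le_rfl).trans
        hXC).trans le_sup_right)
    simpa only [e1, e2] using h1

/-- A family of endomorphisms of a nilpotent group that is unipotent on the abelianization is
unipotent on the whole group (compare P. Hall's nilpotency criterion). -/
theorem unipotent_of_unipotent_abelianization [Group.IsNilpotent Γ]
    (hab : ReflTransGen (UnipotentStep τ) ⊤ ⁅(⊤ : Subgroup Γ), ⊤⁆) :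
    ReflTransGen (UnipotentStep τ) (⊤ : Subgroup Γ) ⊥ := by
  let L : ℕ → Subgroup Γ := fun i => (⊤ : Subgroup Γ).lowerCentralSeries i
  have hsucc : ∀ i, L (i + 1) = ⁅L i, (⊤ : Subgroup Γ)⁆ := fun i => rfl
  have hn : ∀ i, (L i).Normal := by
    intro i
    induction i with
    | zero => exact (inferInstance : (⊤ : Subgroup Γ).Normal)
    | succ i ih => rw [hsucc]; infer_instance
  have hτ : ∀ i m, ∀ z ∈ L i, τ m z ∈ L i := by
    intro i
    induction i with
    | zero => exact fun _ _ _ => Subgroup.mem_top _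
    | succ i ih =>
      intro m
      rw [hsucc]
      exact map_mem_commutator m (ih m) fun _ _ => Subgroup.mem_top _
  have hstep : ∀ i, ReflTransGen (UnipotentStep τ) (L i) (L (i + 1)) := by
    intro i
    induction i with
    | zero => exact hab
    | succ i ih =>
      have := hn i
      have := hn (i + 2)
      have h := chain_commutator_top hab ih (C := L (i + 2)) (hτ _)
        (by rw [hsucc, hsucc]; exact commutator_commutator_top_le (L i))
      rw [← hsucc, ← hsucc, sup_idem] at h
      have hle : L (i + 2) ≤ L (i + 1) := by
        have := hn (i + 1)
        rw [hsucc (i + 1)]; exact Subgroup.commutator_le_left _ _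
      rwa [sup_eq_left.2 hle] at h
  have hall : ∀ i, ReflTransGen (UnipotentStep τ) ⊤ (L i) := by
    intro i
    induction i with
    | zero => exact .refl
    | succ i ih => exact ih.trans (hstep i)
  obtain ⟨s, hs⟩ := (Subgroup.nilpotent_iff_lowerCentralSeries (G := Γ)).1 inferInstance
  have h := hall s
  rwa [show L s = ⊥ from hs] at h

end Chains

/-! ### Polynomial sequences in a nilpotent group -/

section PolynomialSequences

variable {V G : Type*} [AddCommGroup V] [Group G]

/-- The generators of the group of polynomial sequences: the powers `n ↦ x ^ p n`, where the integer
exponent is killed by `e`-fold differences. -/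
def powerSequences (V G : Type*) [AddCommGroup V] [Group G] (e : ℕ) : Set (V → G) :=
  {g | ∃ (x : G) (p : V → ℤ), VanishingDiff e p ∧ g = fun n => x ^ p n}

/-- The group of sequences generated by the powers `n ↦ x ^ p n` with `p` of degree less than
`e`. -/
def polynomialSequences (V G : Type*) [AddCommGroup V] [Group G] (e : ℕ) : Subgroup (V → G) :=
  Subgroup.closure (powerSequences V G e)

/-- The translation `g ↦ g (· + m)` of sequences. -/
def translateSeq (V G : Type*) [AddCommGroup V] [Group G] (m : V) : (V → G) →* (V → G) where
  toFun g n := g (n + m)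
  map_one' := rfl
  map_mul' _ _ := rfl

theorem translateSeq_mem {e : ℕ} (m : V) :
    ∀ g ∈ polynomialSequences V G e, translateSeq V G m g ∈ polynomialSequences V G e := by
  have : polynomialSequences V G e ≤ (polynomialSequences V G e).comap (translateSeq V G m) := by
    rw [polynomialSequences, Subgroup.closure_le]
    rintro _ ⟨x, p, hp, rfl⟩
    exact Subgroup.subset_closure ⟨x, _, hp.shift m, rfl⟩
  exact this

/-- The translation, as an endomorphism of the group of polynomial sequences. -/
def polynomialShift (V G : Type*) [AddCommGroup V] [Group G] (e : ℕ) (m : V) :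
    polynomialSequences V G e →* polynomialSequences V G e :=
  ((translateSeq V G m).comp (polynomialSequences V G e).subtype).codRestrict _
    fun g => translateSeq_mem m (g : V → G) g.2

theorem polynomialShift_apply {e : ℕ} (m n : V) (g : polynomialSequences V G e) :
    (polynomialShift V G e m g : V → G) n = (g : V → G) (n + m) := rfl

/-- Modulo commutators, taking differences lowers the degree of the exponents, so that the
translations are unipotent on the abelianization of the group of polynomial sequences. -/
theorem unipotent_abelianization_polynomialShift (e : ℕ) :
    Relation.ReflTransGen (UnipotentStep (polynomialShift V G e)) ⊤
      ⁅(⊤ : Subgroup (polynomialSequences V G e)), ⊤⁆ := by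
  set Γ := polynomialSequences V G e with hΓ
  let S : ℕ → Set Γ := fun i => {g | (g : V → G) ∈ powerSequences V G i}
  let A : ℕ → Subgroup Γ := fun i => Subgroup.closure (S i) ⊔ ⁅(⊤ : Subgroup Γ), ⊤⁆
  have hA : ∀ i, (A i).Normal := fun i =>
    Subgroup.Normal.of_commutator_le _ le_sup_right
  have hCτ : ∀ m, ∀ z ∈ ⁅(⊤ : Subgroup Γ), ⊤⁆, polynomialShift V G e m z ∈ ⁅(⊤ : Subgroup Γ), ⊤⁆ :=
    fun m => map_mem_commutator m (fun _ _ => Subgroup.mem_top _) fun _ _ => Subgroup.mem_top _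
  have hτ : ∀ i m, ∀ z ∈ A i, polynomialShift V G e m z ∈ A i := by
    intro i m
    refine map_mem_sup m ?_ (hCτ m)
    have : Subgroup.closure (S i) ≤ (Subgroup.closure (S i)).comap (polynomialShift V G e m) := by
      rw [Subgroup.closure_le]
      rintro g ⟨x, p, hp, hg⟩
      refine Subgroup.subset_closure ⟨x, _, hp.shift m, ?_⟩
      funext n
      rw [polynomialShift_apply, hg]
    exact this
  have hstep : ∀ i, UnipotentStep (polynomialShift V G e) (A (i + 1)) (A i) := by
    intro i
    have := hA i
    refine ⟨hA _, hA i, ?_, hτ i, ?_⟩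
    · refine sup_le_sup_right (Subgroup.closure_mono ?_) _
      rintro g ⟨x, p, hp, hg⟩
      exact ⟨x, p, hp.succ, hg⟩
    · suffices h : A (i + 1) ≤ fixedModulo (polynomialShift V G e) (A i) from
        fun m x hx => h hx m
      refine sup_le ?_ fun z hz m => (le_sup_right : _ ≤ A i)
        (Subgroup.mul_mem _ hz (Subgroup.inv_mem _ (hCτ m z hz)))
      rw [Subgroup.closure_le]
      rintro g ⟨x, p, hp, hg⟩ m
      refine (le_sup_left : _ ≤ A i) (Subgroup.subset_closure ⟨x, _, hp m, ?_⟩)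
      funext n
      have : (g : V → G) n * ((g : V → G) (n + m))⁻¹ = x ^ (p n - p (n + m)) := by
        rw [hg, zpow_sub]
      exact this
  have hchain : ∀ i, Relation.ReflTransGen (UnipotentStep (polynomialShift V G e)) (A i) (A 0) := by
    intro i
    induction i with
    | zero => exact .refl
    | succ i ih => exact .head (hstep i) ih
  have htop : A e = ⊤ := by
    have : Subgroup.closure (S e) = ⊤ := Subgroup.closure_closure_coe_preimage
    simp [A, this]
  have hbot : A 0 = ⁅(⊤ : Subgroup Γ), ⊤⁆ := by
    have : Subgroup.closure (S 0) = ⊥ := by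
      rw [Subgroup.closure_eq_bot_iff]
      rintro g ⟨x, p, hp, hg⟩
      refine Subtype.ext ?_
      rw [hg]
      funext n
      simp [hp n]
    simp [A, this]
  have h := hchain e
  rwa [htop, hbot] at h

/-- In a nilpotent group, the translations act unipotently on the group of polynomial sequences of
bounded degree. This takes the place of the Lazard–Leibman theorem. -/
theorem unipotent_polynomialShift [Group.IsNilpotent G] (e : ℕ) :
    Relation.ReflTransGen (UnipotentStep (polynomialShift V G e)) ⊤ ⊥ := by
  have : Group.IsNilpotent (V → G) :=
    Group.isNilpotent_pi_of_bounded_class (Group.nilpotencyClass G) fun _ => le_rfl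
  have : Group.IsNilpotent (polynomialSequences V G e) := Subgroup.isNilpotent _
  exact unipotent_of_unipotent_abelianization (unipotent_abelianization_polynomialShift e)

end PolynomialSequences

/-! ### Reduction of systems of sequences -/

section Reduction

variable {V Γ : Type*} [Group Γ]

/-- A family over `ℕ × W`, regarded as a family over `ℕ × (W × V)`. -/
def liftFamily {W Γ : Type*} (V : Type*) (g : ℕ → W → Γ) : ℕ → W × V → Γ := fun k w => g k w.1

/-- The reduction `⟨g | s⟩_m = g (τ_m g)⁻¹ (τ_m s)`, where the shift `m` is a new index. -/
def vanDerCorput (τ : V → Γ →* Γ) {W : Type*} (g s : ℕ → W → Γ) : ℕ → W × V → Γ :=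
  fun k w => g k w.1 * (τ w.2 (g k w.1))⁻¹ * τ w.2 (s k w.1)

/-- The families over `ℕ × (W × V)` by which the van der Corput type argument replaces a member `g`
of a system whose other members lie in `R`. -/
def reducedSystem (τ : V → Γ →* Γ) {W : Type*} (g : ℕ → W → Γ) (R : Set (ℕ → W → Γ)) :
    Set (ℕ → W × V → Γ) :=
  liftFamily V '' R ∪ vanDerCorput τ g '' R

/-- The families with values in the subgroup `P`. -/
def familiesIn (P : Subgroup Γ) (W : Type*) : Set (ℕ → W → Γ) := {q | ∀ k w, q k w ∈ P}

theorem one_mem_reducedSystem (τ : V → Γ →* Γ) {W : Type*} (g : ℕ → W → Γ)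
    {R : Set (ℕ → W → Γ)} (hR : 1 ∈ R) : 1 ∈ reducedSystem τ g R := Or.inl ⟨1, hR, rfl⟩

/-- The formal properties of a property of systems of families (such as "the associated averages
converge") that suffice to derive it, by induction, for all systems in a group with a unipotent
chain. -/
structure IsReductionStable {V : Type} {Γ : Type*} [Group Γ] (τ : V → Γ →* Γ)
    (Good : ∀ W : Type, Set (ℕ → W → Γ) → Prop) : Prop where
  mono : ∀ {W R S}, R ⊆ S → Good W S → Good W R
  finitary : ∀ {W S}, (∀ T ⊆ S, T.Finite → Good W T) → Good W S
  one : ∀ W, Good W {1}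
  step : ∀ {W R} g, 1 ∈ R → Good (W × V) (reducedSystem τ g R) → Good W (insert g R)

end Reduction

section Induction

variable {V : Type} {Γ : Type*} [Group Γ] {τ : V → Γ →* Γ}

/-- Cosets are stable under the reduction: if `g ∈ c P` and `s ∈ c y Q`, with `y ∈ P` and a unipotent
step from `P` to `Q`, then `⟨g | s⟩ ∈ c y Q`. -/
theorem vanDerCorput_coset {P Q : Subgroup Γ} (hPQ : UnipotentStep τ P Q) {W : Type}
    {c u y z : ℕ → W → Γ} (hu : u ∈ familiesIn P W) (hy : y ∈ familiesIn P W)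
    (hz : z ∈ familiesIn Q W) : ∃ p ∈ familiesIn Q (W × V),
      vanDerCorput τ (c * u) (c * y * z) = liftFamily V c * liftFamily V y * p := by
  refine ⟨(liftFamily V y)⁻¹ * (liftFamily V c)⁻¹ * vanDerCorput τ (c * u) (c * y * z), ?_,
    by group⟩
  rintro k ⟨w, m⟩
  have := hPQ.normal_right
  have h1 : (y k w)⁻¹ * (u k w * (τ m (u k w))⁻¹) * y k w ∈ Q := by
    simpa using Subgroup.Normal.conj_mem inferInstance _ (hPQ.diff_mem m _ (hu k w)) (y k w)⁻¹
  have h2 : (y k w)⁻¹ * τ m (y k w) ∈ Q := by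
    simpa using hPQ.diff_mem m _ (P.inv_mem (hy k w))
  have h3 := Q.mul_mem (Q.mul_mem h1 h2) (hPQ.map_mem m _ (hz k w))
  convert h3 using 1
  simp only [liftFamily, vanDerCorput, Pi.mul_apply, Pi.inv_apply, map_mul]
  group

/-- Adding a coset `c P` to a system `R` preserves goodness, provided that `R` belongs to a class of
good systems that is stable under the reductions by the elements of `c P`.

By induction along the chain: the coset is cut into cosets of the next subgroup, which are removed
one at a time. While the last one, `c q Q`, is being removed, the others are stable under reduction
and so become part of the system `R`. -/
theorem IsReductionStable.good_union_coset {Good : ∀ W : Type, Set (ℕ → W → Γ) → Prop}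
    (hG : IsReductionStable τ Good) {P : Subgroup Γ}
    (hP : Relation.ReflTransGen (UnipotentStep τ) P ⊥) :
    ∀ (C : ∀ W : Type, (ℕ → W → Γ) → Set (ℕ → W → Γ) → Prop),
      (∀ {W c R}, C W c R → ∀ q ∈ familiesIn P W,
        C (W × V) (liftFamily V c) (reducedSystem τ (c * q) R)) →
      (∀ {W c R}, C W c R → Good W R) → (∀ {W c R}, C W c R → 1 ∈ R) →
      ∀ {W c R}, C W c R → Good W (R ∪ {g | ∃ q ∈ familiesIn P W, g = c * q}) := by
  induction hP using Relation.ReflTransGen.head_induction_on with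
  | refl =>
    intro C hC hgood hone W c R hR
    have h1 : Good W (insert c R) := by
      have h := hgood (hC hR 1 fun k w => Subgroup.one_mem _)
      rw [mul_one] at h
      exact hG.step c (hone hR) h
    refine hG.mono ?_ h1
    rintro g (hg | ⟨q, hq, rfl⟩)
    · exact Or.inr hg
    · have : q = 1 := by
        funext k w
        exact Subgroup.mem_bot.1 (hq k w)
      left
      rw [this, mul_one]
  | @head P Q hPQ _ ih =>
    intro C hC hgood hone
    have key : ∀ a : ℕ, ∀ {W c R}, C W c R → ∀ l : List (ℕ → W → Γ), l.length = a →
        (∀ q ∈ l, q ∈ familiesIn P W) →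
        Good W (R ∪ {g | ∃ q ∈ l, ∃ p ∈ familiesIn Q W, g = c * q * p}) := by
      intro a
      induction a with
      | zero =>
        intro W c R hR l hl _
        refine hG.mono ?_ (hgood hR)
        rw [List.length_eq_zero_iff.1 hl]
        rintro g (hg | ⟨q, hq, -⟩)
        · exact hg
        · simp at hq
      | succ a iha =>
        intro W c R hR l hl hlP
        obtain ⟨q, l, rfl⟩ := List.exists_cons_of_length_eq_add_one hl
        have hl' : l.length = a := by simpa using hl
        have h := @ih (fun W c' R' => ∃ (c : ℕ → W → Γ) (R : Set (ℕ → W → Γ))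
          (l : List (ℕ → W → Γ)) (q : ℕ → W → Γ), C W c R ∧ l.length = a ∧
          (∀ x ∈ l, x ∈ familiesIn P W) ∧ q ∈ familiesIn P W ∧ c' = c * q ∧ 1 ∈ R' ∧
          R' ⊆ R ∪ {g | ∃ q ∈ l, ∃ p ∈ familiesIn Q W, g = c * q * p}) ?_ ?_ ?_ W (c * q)
          (R ∪ {g | ∃ q ∈ l, ∃ p ∈ familiesIn Q W, g = c * q * p})
          ⟨c, R, l, q, hR, hl', fun x hx => hlP x (List.mem_cons_of_mem _ hx),
            hlP q List.mem_cons_self, rfl, Or.inl (hone hR), fun _ h => h⟩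
        · refine hG.mono ?_ h
          rintro g (hg | ⟨x, hx, p, hp, rfl⟩)
          · exact Or.inl (Or.inl hg)
          · rcases List.mem_cons.1 hx with rfl | hx
            · exact Or.inr ⟨p, hp, rfl⟩
            · exact Or.inl (Or.inr ⟨x, hx, p, hp, rfl⟩)
        · rintro W c' R' ⟨c, R, l, q, hR, hl, hlP, hq, rfl, h1, hsub⟩ p hp
          have hqp : q * p ∈ familiesIn P W := fun k w => P.mul_mem (hq k w) (hPQ.le (hp k w))
          refine ⟨liftFamily V c, reducedSystem τ (c * (q * p)) R, l.map (liftFamily V),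
            liftFamily V q, hC hR _ hqp, by simpa using hl, ?_, fun k w => hq k w.1, rfl,
            one_mem_reducedSystem _ _ h1, ?_⟩
          · intro x hx
            obtain ⟨y, hy, rfl⟩ := List.mem_map.1 hx
            exact fun k w => hlP y hy k w.1
          · rw [mul_assoc]
            rintro g (⟨s, hs, rfl⟩ | ⟨s, hs, rfl⟩)
            · rcases hsub hs with hs | ⟨y, hy, z, hz, rfl⟩
              · exact Or.inl (Or.inl ⟨s, hs, rfl⟩)
              · exact Or.inr ⟨liftFamily V y, List.mem_map_of_mem hy, liftFamily V z,
                  fun k w => hz k w.1, rfl⟩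
            · rcases hsub hs with hs | ⟨y, hy, z, hz, rfl⟩
              · exact Or.inl (Or.inr ⟨s, hs, rfl⟩)
              · obtain ⟨p', hp', e⟩ := vanDerCorput_coset hPQ (c := c) hqp (hlP y hy) hz
                exact Or.inr ⟨liftFamily V y, List.mem_map_of_mem hy, p', hp', e⟩
        · rintro W c' R' ⟨c, R, l, q, hR, hl, hlP, hq, rfl, h1, hsub⟩
          exact hG.mono hsub (iha hR l hl hlP)
        · rintro W c' R' ⟨c, R, l, q, hR, hl, hlP, hq, rfl, h1, hsub⟩
          exact h1
    intro W c R hR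
    refine hG.finitary fun T hT hTf => ?_
    classical
    let l := (hTf.toFinset.toList.filter fun t => c⁻¹ * t ∈ familiesIn P W).map fun t => c⁻¹ * t
    refine hG.mono ?_ (key l.length hR l rfl ?_)
    · intro t ht
      rcases hT ht with h | ⟨q, hq, rfl⟩
      · exact Or.inl h
      · refine Or.inr ⟨q, List.mem_map.2 ⟨c * q, ?_, by simp⟩, 1, fun k w => Q.one_mem, by simp⟩
        simpa using ⟨ht, hq⟩
    · intro q hq
      obtain ⟨t, ht, rfl⟩ := List.mem_map.1 hq
      simpa using (List.mem_filter.1 ht).2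

/-- A property stable under reductions holds for all systems of families in a group on which `τ`
acts unipotently. -/
theorem IsReductionStable.good_familiesIn {Good : ∀ W : Type, Set (ℕ → W → Γ) → Prop}
    (hG : IsReductionStable τ Good) {P : Subgroup Γ}
    (hP : Relation.ReflTransGen (UnipotentStep τ) P ⊥) : ∀ W, Good W (familiesIn P W) := by
  induction hP using Relation.ReflTransGen.head_induction_on with
  | refl =>
    refine fun W => hG.mono (fun q hq => ?_) (hG.one W)
    rw [Set.mem_singleton_iff]
    funext k w
    exact Subgroup.mem_bot.1 (hq k w)
  | @head P Q hPQ hQ ih =>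
    intro W
    have h := hG.good_union_coset (P := P) (.head hPQ hQ)
      (fun W c R => c = 1 ∧ 1 ∈ R ∧ R ⊆ familiesIn Q W) ?_ ?_ ?_ (W := W) (c := 1)
      (R := familiesIn Q W) ⟨rfl, fun k w => Q.one_mem, fun _ h => h⟩
    · exact hG.mono (fun q hq => Or.inr ⟨q, hq, (one_mul q).symm⟩) h
    · rintro W c R ⟨rfl, h1, hR⟩ q hq
      refine ⟨rfl, one_mem_reducedSystem _ _ h1, ?_⟩
      rintro g (⟨s, hs, rfl⟩ | ⟨s, hs, rfl⟩)
      · exact fun k w => hR hs k w.1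
      · rintro k ⟨w, m⟩
        rw [one_mul]
        exact Q.mul_mem (hPQ.diff_mem m _ (hq k w)) (hPQ.map_mem m _ (hR hs k w))
    · rintro W c R ⟨-, -, hR⟩
      exact hG.mono hR (ih W)
    · rintro W c R ⟨-, h1, -⟩
      exact h1

end Induction

/-! ### Averages over finite sets -/

section Averages

/-- The average of `f` over the finite set `s` (zero if `s` is empty). -/
noncomputable def finAvg (𝕜 : Type*) [RCLike 𝕜] {α E : Type*} [AddCommMonoid E] [Module 𝕜 E]
    (s : Finset α) (f : α → E) : E := (s.card : 𝕜)⁻¹ • ∑ i ∈ s, f i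

variable {𝕜 : Type*} [RCLike 𝕜] {α β E : Type*}

theorem finAvg_add [AddCommGroup E] [Module 𝕜 E] (s : Finset α) (f g : α → E) :
    finAvg 𝕜 s (fun i => f i + g i) = finAvg 𝕜 s f + finAvg 𝕜 s g := by
  simp [finAvg, Finset.sum_add_distrib, smul_add]

theorem finAvg_sub [AddCommGroup E] [Module 𝕜 E] (s : Finset α) (f g : α → E) :
    finAvg 𝕜 s (fun i => f i - g i) = finAvg 𝕜 s f - finAvg 𝕜 s g := by
  simp [finAvg, Finset.sum_sub_distrib, smul_sub]

theorem finAvg_smul [AddCommGroup E] [Module 𝕜 E] (s : Finset α) (c : 𝕜) (f : α → E) :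
    finAvg 𝕜 s (fun i => c • f i) = c • finAvg 𝕜 s f := by
  simp [finAvg, ← Finset.smul_sum, smul_comm c]

theorem map_finAvg {E' : Type*} [AddCommGroup E] [Module 𝕜 E] [AddCommGroup E'] [Module 𝕜 E']
    (T : E →ₗ[𝕜] E') (s : Finset α) (f : α → E) :
    T (finAvg 𝕜 s f) = finAvg 𝕜 s fun i => T (f i) := by
  simp [finAvg]

theorem finAvg_product [AddCommGroup E] [Module 𝕜 E] (s : Finset α) (t : Finset β)
    (f : α × β → E) :
    finAvg 𝕜 (s ×ˢ t) f = finAvg 𝕜 s fun a => finAvg 𝕜 t fun b => f (a, b) := by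
  simp only [finAvg, Finset.card_product, Finset.sum_product, Nat.cast_mul, mul_inv,
    ← Finset.smul_sum, mul_smul]

theorem finAvg_comm [AddCommGroup E] [Module 𝕜 E] (s : Finset α) (t : Finset β)
    (f : α → β → E) :
    finAvg 𝕜 s (fun a => finAvg 𝕜 t fun b => f a b) =
      finAvg 𝕜 t fun b => finAvg 𝕜 s fun a => f a b := by
  simp only [finAvg, ← Finset.smul_sum]
  rw [Finset.sum_comm, smul_comm]

theorem finAvg_const [AddCommGroup E] [Module 𝕜 E] {s : Finset α} (hs : s.Nonempty) (c : E) :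
    finAvg 𝕜 s (fun _ => c) = c := by
  have : (s.card : 𝕜) ≠ 0 := by simpa using hs.ne_empty
  rw [finAvg, Finset.sum_const, ← Nat.cast_smul_eq_nsmul 𝕜, smul_smul, inv_mul_cancel₀ this,
    one_smul]

theorem finAvg_mono {s : Finset α} {f g : α → ℝ} (h : ∀ i ∈ s, f i ≤ g i) :
    finAvg ℝ s f ≤ finAvg ℝ s g := by
  simp only [finAvg, smul_eq_mul]
  exact mul_le_mul_of_nonneg_left (Finset.sum_le_sum h) (by positivity)

theorem finAvg_nonneg {s : Finset α} {f : α → ℝ} (h : ∀ i ∈ s, 0 ≤ f i) : 0 ≤ finAvg ℝ s f := by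
  simp only [finAvg, smul_eq_mul]
  exact mul_nonneg (by positivity) (Finset.sum_nonneg h)

theorem finAvg_le_of_le {s : Finset α} {f : α → ℝ} {C : ℝ} (hC : 0 ≤ C)
    (h : ∀ i ∈ s, f i ≤ C) : finAvg ℝ s f ≤ C := by
  rcases s.eq_empty_or_nonempty with rfl | hs
  · simpa [finAvg] using hC
  · exact (finAvg_mono h).trans (finAvg_const hs C).le

theorem norm_finAvg_le [SeminormedAddCommGroup E] [NormedSpace 𝕜 E] (s : Finset α) (f : α → E) :
    ‖finAvg 𝕜 s f‖ ≤ finAvg ℝ s fun i => ‖f i‖ := by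
  simp only [finAvg, smul_eq_mul, norm_smul, norm_inv, RCLike.norm_natCast]
  exact mul_le_mul_of_nonneg_left (norm_sum_le _ _) (by positivity)

theorem norm_finAvg_le_of_le [SeminormedAddCommGroup E] [NormedSpace 𝕜 E] {s : Finset α}
    {f : α → E} {C : ℝ} (hC : 0 ≤ C) (h : ∀ i ∈ s, ‖f i‖ ≤ C) : ‖finAvg 𝕜 s f‖ ≤ C :=
  (norm_finAvg_le s f).trans (finAvg_le_of_le hC h)

theorem sq_finAvg_le (s : Finset α) (f : α → ℝ) :
    finAvg ℝ s f ^ 2 ≤ finAvg ℝ s fun i => f i ^ 2 := by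
  rcases s.eq_empty_or_nonempty with rfl | hs
  · simp [finAvg]
  have hc : (0 : ℝ) < s.card := by exact_mod_cast hs.card_pos
  simp only [finAvg, smul_eq_mul, mul_pow]
  have h := sq_sum_le_card_mul_sum_sq (s := s) (f := f)
  calc ((s.card : ℝ)⁻¹) ^ 2 * (∑ i ∈ s, f i) ^ 2
      ≤ ((s.card : ℝ)⁻¹) ^ 2 * (s.card * ∑ i ∈ s, f i ^ 2) :=
        mul_le_mul_of_nonneg_left h (by positivity)
    _ = (s.card : ℝ)⁻¹ * ∑ i ∈ s, f i ^ 2 := by field_simp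

theorem norm_sq_finAvg_le [SeminormedAddCommGroup E] [NormedSpace 𝕜 E] (s : Finset α)
    (f : α → E) : ‖finAvg 𝕜 s f‖ ^ 2 ≤ finAvg ℝ s fun i => ‖f i‖ ^ 2 :=
  (pow_le_pow_left₀ (norm_nonneg _) (norm_finAvg_le s f) 2).trans (sq_finAvg_le s _)

theorem re_inner_finAvg_right [SeminormedAddCommGroup E] [InnerProductSpace 𝕜 E] (s : Finset α)
    (f : α → E) (x : E) : RCLike.re (inner 𝕜 x (finAvg 𝕜 s f)) =
      finAvg ℝ s fun i => RCLike.re (inner 𝕜 x (f i)) := by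
  simp only [finAvg, inner_smul_right, inner_sum, smul_eq_mul]
  rw [← RCLike.ofReal_natCast, ← RCLike.ofReal_inv, RCLike.re_ofReal_mul, map_sum]

theorem re_inner_finAvg_left [SeminormedAddCommGroup E] [InnerProductSpace 𝕜 E] (s : Finset α)
    (f : α → E) (x : E) : RCLike.re (inner 𝕜 (finAvg 𝕜 s f) x) =
      finAvg ℝ s fun i => RCLike.re (inner 𝕜 (f i) x) := by
  rw [inner_re_symm, re_inner_finAvg_right]
  simp only [inner_re_symm x]

open Classical in
/-- The relative size of the symmetric difference of `v + s` and `s`. -/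
noncomputable def translateDefect {V : Type*} [Add V] (v : V) (s : Finset V) : ℝ :=
  (s.card : ℝ)⁻¹ * (symmDiff (s.image (v + ·)) s).card

/-- A Følner sequence of finite subsets of an additive group. -/
structure IsFinsetFoelner {V : Type*} [Add V] (Φ : ℕ → Finset V) : Prop where
  nonempty : ∀ᶠ N in atTop, (Φ N).Nonempty
  tendsto_defect : ∀ v, Tendsto (fun N => translateDefect v (Φ N)) atTop (𝓝 0)

theorem norm_finAvg_sub_translate_le {V : Type*} [AddCommGroup V] [SeminormedAddCommGroup E]
    [NormedSpace 𝕜 E] (s : Finset V) (v : V) {ψ : V → E} {C : ℝ} (hψ : ∀ n, ‖ψ n‖ ≤ C) :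
    ‖finAvg 𝕜 s ψ - finAvg 𝕜 s fun m => ψ (v + m)‖ ≤ translateDefect v s * C := by
  classical
  have h1 : ∑ m ∈ s, ψ (v + m) = ∑ n ∈ s.image (v + ·), ψ n := by
    rw [Finset.sum_image fun a _ b _ h => add_left_cancel h]
  have h2 : ‖∑ n ∈ s, ψ n - ∑ n ∈ s.image (v + ·), ψ n‖ ≤
      (symmDiff (s.image (v + ·)) s).card * C := by
    rw [← Finset.sum_sdiff_sub_sum_sdiff]
    have hb : ∀ t : Finset V, ‖∑ n ∈ t, ψ n‖ ≤ t.card * C := fun t => by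
      simpa using norm_sum_le_of_le t fun n _ => hψ n
    have hcard : (symmDiff (s.image (v + ·)) s).card =
        (s \ s.image (v + ·)).card + (s.image (v + ·) \ s).card := by
      rw [symmDiff, Finset.sup_eq_union, Finset.card_union_of_disjoint, add_comm]
      exact disjoint_sdiff_sdiff
    rw [hcard, Nat.cast_add, add_mul]
    exact (norm_sub_le _ _).trans (add_le_add (hb _) (hb _))
  simp only [finAvg, ← smul_sub, norm_smul, norm_inv, RCLike.norm_natCast, h1, translateDefect]
  rw [mul_assoc]
  refine mul_le_mul_of_nonneg_left ?_ (by positivity)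
  convert h2

/-- The mean square of a function on a finite set. -/
noncomputable def meanSq {W H : Type*} [Norm H] (S : Finset W) (F : W → H) : ℝ :=
  finAvg ℝ S fun w => ‖F w‖ ^ 2

theorem meanSq_nonneg {W H : Type*} [Norm H] (S : Finset W) (F : W → H) : 0 ≤ meanSq S F :=
  finAvg_nonneg fun _ _ => by positivity

theorem meanSq_add_add_le {W H : Type*} [SeminormedAddCommGroup H] (S : Finset W)
    (a b c : W → H) : meanSq S (fun w => a w + b w + c w) ≤
      3 * (meanSq S a + meanSq S b + meanSq S c) := by
  have : 3 * (meanSq S a + meanSq S b + meanSq S c) =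
      finAvg ℝ S fun w => 3 * (‖a w‖ ^ 2 + ‖b w‖ ^ 2 + ‖c w‖ ^ 2) := by
    simp only [meanSq, ← finAvg_add, ← smul_eq_mul, ← finAvg_smul]
  rw [this]
  refine finAvg_mono fun w _ => ?_
  have h1 : ‖a w + b w + c w‖ ≤ ‖a w‖ + ‖b w‖ + ‖c w‖ := norm_add₃_le
  have h2 := pow_le_pow_left₀ (norm_nonneg _) h1 2
  nlinarith [sq_nonneg (‖a w‖ - ‖b w‖), sq_nonneg (‖b w‖ - ‖c w‖), sq_nonneg (‖a w‖ - ‖c w‖)]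

theorem meanSq_sub {W H : Type*} [SeminormedAddCommGroup H] [InnerProductSpace 𝕜 H] (S : Finset W)
    (a b : W → H) : meanSq S (fun w => a w - b w) =
      meanSq S a - 2 * finAvg ℝ S (fun w => RCLike.re (inner 𝕜 (a w) (b w))) + meanSq S b := by
  simp only [meanSq, ← smul_eq_mul, ← finAvg_smul, ← finAvg_sub, ← finAvg_add]
  congr 1
  funext w
  rw [@norm_sub_sq 𝕜]
  rfl

end Averages

/-! ### Asymptotic notions along an ultrafilter -/

section Ultrafilter

/-- Countable saturation of ultraproducts over `ℕ`: a property that holds, for arbitrarily large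
`N`, at almost every `k`, holds at almost every `k` for some `N k` tending to infinity. -/
theorem exists_tendsto_of_frequently {P : ℕ → ℕ → Prop}
    (h : ∀ M, ∃ N ≥ M, ∀ᶠ k in (hyperfilter ℕ : Filter ℕ), P N k) :
    ∃ K : ℕ → ℕ, Tendsto K (hyperfilter ℕ : Filter ℕ) atTop ∧
      ∀ᶠ k in (hyperfilter ℕ : Filter ℕ), P (K k) k := by
  classical
  refine ⟨fun k => Nat.findGreatest (P · k) k, ?_, ?_⟩
  · refine tendsto_atTop.2 fun M => ?_
    obtain ⟨N, hN, hP⟩ := h M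
    filter_upwards [hP, Nat.hyperfilter_le_atTop (eventually_ge_atTop N)] with k hk hkN
    exact hN.trans (Nat.le_findGreatest hkN hk)
  · obtain ⟨N, -, hP⟩ := h 0
    filter_upwards [hP, Nat.hyperfilter_le_atTop (eventually_ge_atTop N)] with k hk hkN
    exact Nat.findGreatest_spec (P := (P · k)) hkN hk

/-- The sequence `a N`, of families over `ℕ × W`, is Cauchy for the seminorm given by the limit
along the ultrafilter, in `k`, of the mean squares over `S k`. -/
def IsAsympCauchy {W H : Type*} [SeminormedAddCommGroup H] (S : ℕ → Finset W)
    (a : ℕ → ℕ → W → H) : Prop :=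
  ∀ ε > 0, ∃ M, ∀ N ≥ M, ∀ N' ≥ M, ∀ᶠ k in (hyperfilter ℕ : Filter ℕ),
    meanSq (S k) (fun w => a N k w - a N' k w) ≤ ε

variable {𝕜 : Type*} [RCLike 𝕜] {W H : Type*} [SeminormedAddCommGroup H]

/-- An approximate orthogonal projection: every bounded family `F` has an approximation `b` in the
subspace `K` such that `F - b` is nearly orthogonal to each `σ ∈ K`. Nothing has to be complete,
because `b` need only nearly minimise the distance to `F`. -/
theorem exists_almost_orthogonal [InnerProductSpace 𝕜 H] {E : Type*} [AddCommGroup E] [Module 𝕜 E]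
    (ι : E →ₗ[𝕜] H) (S : ℕ → Finset W)
    (K : Submodule 𝕜 (ℕ → W → E)) {F : ℕ → W → E} {C : ℝ} (hF : ∀ k w, ‖ι (F k w)‖ ≤ C)
    {δ : ℝ} (hδ : 0 < δ) :
    ∃ b ∈ K, ∀ σ ∈ K, ∀ᶠ k in (hyperfilter ℕ : Filter ℕ),
      2 * finAvg ℝ (S k) (fun w => RCLike.re (inner 𝕜 (ι (F k w - b k w)) (ι (σ k w)))) ≤
        δ + meanSq (S k) (fun w => ι (σ k w)) := by
  let D : Set ℝ := {c | 0 ≤ c ∧ ∃ b ∈ K, ∀ᶠ k in (hyperfilter ℕ : Filter ℕ),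
    meanSq (S k) (fun w => ι (F k w - b k w)) ≤ c}
  have hD : BddBelow D := ⟨0, fun c hc => hc.1⟩
  have hDne : D.Nonempty := by
    refine ⟨C ^ 2, by positivity, 0, K.zero_mem, .of_forall fun k => ?_⟩
    refine finAvg_le_of_le (by positivity) fun w _ => ?_
    simpa using pow_le_pow_left₀ (norm_nonneg _) (hF k w) 2
  obtain ⟨c, ⟨-, b, hb, hc⟩, hcD⟩ := exists_lt_of_csInf_lt hDne
    (lt_add_of_pos_right (sInf D) (half_pos hδ))
  refine ⟨b, hb, fun σ hσ => ?_⟩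
  have hfar : ∀ᶠ k in (hyperfilter ℕ : Filter ℕ),
      sInf D - δ / 2 ≤ meanSq (S k) (fun w => ι (F k w - (b + σ) k w)) := by
    by_contra hcon
    rw [← Ultrafilter.eventually_not] at hcon
    have h1 : ∀ᶠ k in (hyperfilter ℕ : Filter ℕ),
        meanSq (S k) (fun w => ι (F k w - (b + σ) k w)) ≤ sInf D - δ / 2 :=
      hcon.mono fun k hk => (not_le.1 hk).le
    obtain ⟨k, hk⟩ := h1.exists
    have := csInf_le hD ⟨(meanSq_nonneg _ _).trans hk, b + σ, K.add_mem hb hσ, h1⟩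
    linarith
  filter_upwards [hfar, hc] with k hk hck
  have e1 : (fun w => ι (F k w - (b + σ) k w)) = fun w => ι (F k w - b k w) - ι (σ k w) := by
    funext w
    rw [← map_sub, Pi.add_apply, Pi.add_apply, sub_sub]
  rw [e1, meanSq_sub (𝕜 := 𝕜)] at hk
  linarith

end Ultrafilter

/-! ### Multiple averages in an abstract system -/

/-- The abstract counterpart of `L^∞ ⊆ L²`, with a group of measure preserving transformations:
a linear map `ι` from a commutative star algebra `A`, on which `G` acts isometrically, to an inner
product space `H`, for which multiplication is bounded with adjoint given by `star`, and `G` acts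
unitarily. -/
structure IsInvariantRepr (𝕜 G : Type*) {A H : Type*} [RCLike 𝕜] [NormedCommRing A]
    [NormedAlgebra 𝕜 A] [StarRing A] [SeminormedAddCommGroup H] [InnerProductSpace 𝕜 H] [Group G]
    [MulSemiringAction G A] (ι : A →ₗ[𝕜] H) : Prop where
  norm_map_mul_le : ∀ a b, ‖ι (a * b)‖ ≤ ‖a‖ * ‖ι b‖
  inner_map_mul : ∀ a b c, inner 𝕜 (ι (a * b)) (ι c) = inner 𝕜 (ι b) (ι (star a * c))
  inner_map_smul : ∀ (g : G) a b, inner 𝕜 (ι (g • a)) (ι (g • b)) = inner 𝕜 (ι a) (ι b)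
  norm_smul : ∀ (g : G) (a : A), ‖g • a‖ = ‖a‖
  star_smul : ∀ (g : G) (a : A), star (g • a) = g • star a
  norm_star : ∀ a : A, ‖star a‖ = ‖a‖

section MultipleAverages

variable {𝕜 G A H : Type*} [RCLike 𝕜] [NormedCommRing A]
  [NormedAlgebra 𝕜 A] [StarRing A] [SeminormedAddCommGroup H] [InnerProductSpace 𝕜 H] [Group G]
  [MulSemiringAction G A] [SMulCommClass G 𝕜 A]

/-- A family of elements that is uniformly bounded in norm. -/
def IsUnifBounded {T A : Type*} [Norm A] (f : T → A) : Prop := ∃ C, ∀ t, ‖f t‖ ≤ C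

theorem IsUnifBounded.exists_pos {T : Type*} {f : T → A} (h : IsUnifBounded f) :
    ∃ C > 0, ∀ t, ‖f t‖ ≤ C := by
  obtain ⟨C, hC⟩ := h
  exact ⟨max C 1, by positivity, fun t => (hC t).trans (le_max_left _ _)⟩

theorem IsUnifBounded.mul {T : Type*} {f g : T → A} (hf : IsUnifBounded f)
    (hg : IsUnifBounded g) : IsUnifBounded fun t => f t * g t := by
  obtain ⟨C, hC0, hC⟩ := hf.exists_pos
  obtain ⟨D, hD0, hD⟩ := hg.exists_pos
  exact ⟨C * D, fun t => (norm_mul_le _ _).trans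
    (mul_le_mul (hC t) (hD t) (norm_nonneg _) hC0.le)⟩

theorem IsUnifBounded.prod {T J : Type*} (s : Finset J) {f : J → T → A}
    (hf : ∀ j, IsUnifBounded (f j)) : IsUnifBounded fun t => ∏ j ∈ s, f j t := by
  classical
  induction s using Finset.induction_on with
  | empty => exact ⟨‖(1 : A)‖, fun t => by simp⟩
  | insert a s ha ih => simpa only [Finset.prod_insert ha] using (hf a).mul ih

/-- The average over `n ∈ s` of `∏ j, ev n (g j) • f j`. -/
noncomputable def multiAvg (𝕜 : Type*) {V Γ G A J : Type*} [RCLike 𝕜] [NormedCommRing A]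
    [NormedAlgebra 𝕜 A] [Group G] [MulSemiringAction G A] [Group Γ] [Fintype J] (ev : V → Γ →* G)
    (s : Finset V) (g : J → Γ) (f : J → A) : A :=
  finAvg 𝕜 s fun n => ∏ j, ev n (g j) • f j

/-- A system `R` of families is convergent if the multiple averages along all finite choices of
sequences from `R` are asymptotically Cauchy, for all bounded families of functions and all choices
of finite index sets. In a family over `ℕ × W`, the first index is the coordinate of the
ultraproduct and `W` holds the shifts from earlier reductions. A sequence may be chosen several
times, so only the set `R` matters. -/
def IsConvergentSystem {V Γ : Type*} [Group Γ] (ev : V → Γ →* G) (Φ : ℕ → Finset V)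
    (ι : A →ₗ[𝕜] H) (W : Type) (R : Set (ℕ → W → Γ)) : Prop :=
  ∀ (J : Type) [Fintype J] (g : J → ℕ → W → Γ), (∀ j, g j ∈ R) →
    ∀ f : J → ℕ → W → A, (∀ j, IsUnifBounded fun t : ℕ × W => f j t.1 t.2) →
      ∀ S : ℕ → Finset W, IsAsympCauchy S fun N k w =>
        ι (multiAvg 𝕜 ev (Φ N) (fun j => g j k w) fun j => f j k w)

variable {V : Type} {Γ : Type*} [AddCommGroup V] [Group Γ] {ev : V → Γ →* G}
  {τ : V → Γ →* Γ} {Φ : ℕ → Finset V} {ι : A →ₗ[𝕜] H}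

/-- The average over `n ∈ s` of `P n * ev n g • b`. -/
noncomputable def weightedAvg (𝕜 : Type*) {V Γ G A : Type*} [RCLike 𝕜] [NormedCommRing A]
    [NormedAlgebra 𝕜 A] [Group G] [MulSemiringAction G A] [Group Γ] (ev : V → Γ →* G)
    (s : Finset V) (P : V → A) (g : Γ) (b : A) : A :=
  finAvg 𝕜 s fun n => P n * ev n g • b

/-- The element dual to `h` for the averages with weights `P`: pairing with it is pairing the
average with `h`. -/
noncomputable def dualAvg (𝕜 : Type*) {V Γ G A : Type*} [RCLike 𝕜] [NormedCommRing A]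
    [NormedAlgebra 𝕜 A] [StarRing A] [Group G] [MulSemiringAction G A] [Group Γ] (ev : V → Γ →* G)
    (s : Finset V) (P : V → A) (g : Γ) (h : A) : A :=
  finAvg 𝕜 s fun n => (ev n g)⁻¹ • (star (P n) * h)

section Weighted

variable (s : Finset V) (P : V → A) (g : Γ)

theorem weightedAvg_add (a b : A) : weightedAvg 𝕜 ev s P g (a + b) =
    weightedAvg 𝕜 ev s P g a + weightedAvg 𝕜 ev s P g b := by
  simp only [weightedAvg, smul_add, mul_add, finAvg_add]

theorem weightedAvg_smul (c : 𝕜) (a : A) : weightedAvg 𝕜 ev s P g (c • a) =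
    c • weightedAvg 𝕜 ev s P g a := by
  simp only [weightedAvg, smul_comm _ c, mul_smul_comm, finAvg_smul]

variable {s P g}

theorem norm_weightedAvg_le (hι : IsInvariantRepr 𝕜 G ι) {C : ℝ} (hC : 0 ≤ C)
    (hP : ∀ n, ‖P n‖ ≤ C) (a : A) : ‖weightedAvg 𝕜 ev s P g a‖ ≤ C * ‖a‖ := by
  refine norm_finAvg_le_of_le (by positivity) fun n _ => (norm_mul_le _ _).trans ?_
  rw [hι.norm_smul]
  exact mul_le_mul_of_nonneg_right (hP n) (norm_nonneg _)

theorem norm_dualAvg_le (hι : IsInvariantRepr 𝕜 G ι) {C : ℝ} (hC : 0 ≤ C)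
    (hP : ∀ n, ‖P n‖ ≤ C) (h : A) : ‖dualAvg 𝕜 ev s P g h‖ ≤ C * ‖h‖ := by
  refine norm_finAvg_le_of_le (by positivity) fun n _ => ?_
  rw [hι.norm_smul]
  refine (norm_mul_le _ _).trans ?_
  rw [hι.norm_star]
  exact mul_le_mul_of_nonneg_right (hP n) (norm_nonneg _)

theorem IsInvariantRepr.norm_map_smul (hι : IsInvariantRepr 𝕜 G ι) (γ : G) (a : A) :
    ‖ι (γ • a)‖ = ‖ι a‖ := by
  rw [@norm_eq_sqrt_re_inner 𝕜, hι.inner_map_smul, ← norm_eq_sqrt_re_inner]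

theorem IsInvariantRepr.norm_map_le (hι : IsInvariantRepr 𝕜 G ι) (a : A) :
    ‖ι a‖ ≤ ‖a‖ * ‖ι 1‖ := by
  simpa using hι.norm_map_mul_le a 1

theorem norm_map_dualAvg_le (hι : IsInvariantRepr 𝕜 G ι) {C : ℝ} (hC : 0 ≤ C)
    (hP : ∀ n, ‖P n‖ ≤ C) (h : A) : ‖ι (dualAvg 𝕜 ev s P g h)‖ ≤ C * ‖ι h‖ := by
  rw [dualAvg, map_finAvg]
  refine norm_finAvg_le_of_le (by positivity) fun n _ => ?_
  rw [hι.norm_map_smul]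
  refine (hι.norm_map_mul_le _ _).trans ?_
  rw [hι.norm_star]
  exact mul_le_mul_of_nonneg_right (hP n) (norm_nonneg _)

theorem re_inner_dualAvg (hι : IsInvariantRepr 𝕜 G ι) (e h : A) :
    RCLike.re (inner 𝕜 (ι e) (ι (dualAvg 𝕜 ev s P g h))) =
      RCLike.re (inner 𝕜 (ι (weightedAvg 𝕜 ev s P g e)) (ι h)) := by
  rw [dualAvg, weightedAvg, map_finAvg, map_finAvg, re_inner_finAvg_right, re_inner_finAvg_left]
  congr 1
  funext n
  rw [hι.inner_map_mul, ← hι.inner_map_smul (ev n g)⁻¹ (ev n g • e), inv_smul_smul]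

end Weighted

theorem reduced_multiAvg_eq (hι : IsInvariantRepr 𝕜 G ι)
    (hev : ∀ n m g, ev n (τ m g) = ev (n + m) g) {J : Type} [Fintype J] (s : Finset V) (m : V)
    (g : J → Γ) (f : J → A) (g₀ : Γ) (h : A) :
    multiAvg 𝕜 ev s
      (Sum.elim g fun o : Option J => g₀ * (τ m g₀)⁻¹ * τ m (o.elim 1 g))
      (Sum.elim f fun o : Option J => o.elim h fun j => star (f j)) =
    finAvg 𝕜 s fun l => (∏ j, ev l (g j) • f j) * ev l g₀ • (ev (l + m) g₀)⁻¹ •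
      (star (∏ j, ev (l + m) (g j) • f j) * h) := by
  rw [multiAvg]
  congr 1
  funext l
  rw [Fintype.prod_sum_type, Fintype.prod_option]
  simp only [Sum.elim_inl, Sum.elim_inr, Option.elim_none, Option.elim_some, map_mul, map_one,
    map_inv, hev, mul_one, star_prod, hι.star_smul, smul_mul', Finset.smul_prod', mul_smul]
  congr 1
  rw [mul_comm]

/-- The dual elements have asymptotically Cauchy averages as soon as the reduced system is
convergent: translating the summation index turns their averages into means of averages of the
reduced system. -/
theorem isAsympCauchy_dualAvg (hι : IsInvariantRepr 𝕜 G ι) (hΦ : IsFinsetFoelner Φ)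
    (hev : ∀ n m g, ev n (τ m g) = ev (n + m) g) {W : Type} {R : Set (ℕ → W → Γ)}
    {g₀ : ℕ → W → Γ} (h1 : 1 ∈ R)
    (hR : IsConvergentSystem ev Φ ι (W × V) (reducedSystem τ g₀ R))
    {J : Type} [Fintype J] {g : J → ℕ → W → Γ} (hg : ∀ j, g j ∈ R) {f : J → ℕ → W → A}
    (hf : ∀ j, IsUnifBounded fun t : ℕ × W => f j t.1 t.2) {h : ℕ → W → A}
    (hh : IsUnifBounded fun t : ℕ × W => h t.1 t.2) {K : ℕ → ℕ}
    (hK : Tendsto K (hyperfilter ℕ : Filter ℕ) atTop) (S : ℕ → Finset W) :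
    IsAsympCauchy S fun N k w => ι (weightedAvg 𝕜 ev (Φ N)
      (fun n => ∏ j, ev n (g j k w) • f j k w) (g₀ k w)
      (dualAvg 𝕜 ev (Φ (K k)) (fun n => ∏ j, ev n (g j k w) • f j k w) (g₀ k w) (h k w))) := by
  classical
  set P : ℕ → W → V → A := fun k w n => ∏ j, ev n (g j k w) • f j k w with hP
  obtain ⟨C, hC0, hC⟩ : ∃ C > 0, ∀ k w n, ‖P k w n‖ ≤ C := by
    have : IsUnifBounded fun t : ℕ × W × V => P t.1 t.2.1 t.2.2 :=
      IsUnifBounded.prod _ fun j => by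
        obtain ⟨C, hC⟩ := hf j
        exact ⟨C, fun t => by rw [hι.norm_smul]; exact hC (t.1, t.2.1)⟩
    obtain ⟨C, hC0, hC⟩ := this.exists_pos
    exact ⟨C, hC0, fun k w n => hC (k, w, n)⟩
  obtain ⟨Ch, hCh0, hCh⟩ := hh.exists_pos
  let ψ : ℕ → W → V → V → A := fun k w l n =>
    P k w l * ev l (g₀ k w) • (ev n (g₀ k w))⁻¹ • (star (P k w n) * h k w)
  have hψ : ∀ k w l n, ‖ψ k w l n‖ ≤ C * (C * Ch) := by
    intro k w l n
    refine (norm_mul_le _ _).trans ?_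
    rw [hι.norm_smul, hι.norm_smul]
    refine mul_le_mul (hC _ _ _) ((norm_mul_le _ _).trans ?_) (norm_nonneg _) hC0.le
    rw [hι.norm_star]
    exact mul_le_mul (hC _ _ _) (hCh (k, w)) (norm_nonneg _) hC0.le
  -- the averages of the reduced system, as functions of the new index `m`
  let B : ℕ → ℕ → W × V → A := fun N k w => finAvg 𝕜 (Φ N) fun l => ψ k w.1 l (l + w.2)
  have hB : IsAsympCauchy (fun k => S k ×ˢ Φ (K k)) fun N k w => ι (B N k w) := by
    have := hR (J ⊕ Option J)
      (Sum.elim (fun j => liftFamily V (g j))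
        fun o => vanDerCorput τ g₀ (o.elim 1 g))
      (by
        rintro (j | _ | j)
        · exact Or.inl ⟨_, hg j, rfl⟩
        · exact Or.inr ⟨_, h1, rfl⟩
        · exact Or.inr ⟨_, hg j, rfl⟩)
      (Sum.elim (fun j => liftFamily V (f j))
        fun o => liftFamily V (o.elim h fun j k w => star (f j k w)))
      (by
        rintro (j | _ | j)
        · obtain ⟨D, hD⟩ := hf j
          exact ⟨D, fun t => hD (t.1, t.2.1)⟩
        · exact ⟨Ch, fun t => hCh (t.1, t.2.1)⟩
        · obtain ⟨D, hD⟩ := hf j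
          exact ⟨D, fun t => by
            simp only [Sum.elim_inr, Option.elim_some, liftFamily, hι.norm_star]
            exact hD (t.1, t.2.1)⟩)
      (fun k => S k ×ˢ Φ (K k))
    convert this using 5 with N k w
    refine (reduced_multiAvg_eq hι hev (Φ N) w.2 (fun j => g j k w.1) (fun j => f j k w.1)
      (g₀ k w.1) (h k w.1)).symm.trans ?_
    congr 1
    · funext o
      rcases o with j | _ | j <;> rfl
    · funext o
      rcases o with j | _ | j <;> rfl
  let T : ℕ → ℕ → W → A := fun N k w => weightedAvg 𝕜 ev (Φ N) (P k w) (g₀ k w)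
    (dualAvg 𝕜 ev (Φ (K k)) (P k w) (g₀ k w) (h k w))
  have hT : ∀ N k w, T N k w = finAvg 𝕜 (Φ N) fun l => finAvg 𝕜 (Φ (K k)) fun n => ψ k w l n := by
    intro N k w
    refine congrArg (finAvg 𝕜 (Φ N)) (funext fun l => ?_)
    simp only [dualAvg, ψ, finAvg, smul_comm (ev l (g₀ k w)), mul_smul_comm, Finset.smul_sum,
      Finset.mul_sum]
  have hclose : ∀ N, ∀ η > 0, ∀ᶠ k in (hyperfilter ℕ : Filter ℕ), ∀ w,
      ‖ι (T N k w - finAvg 𝕜 (Φ (K k)) fun m => B N k (w, m))‖ ≤ η := by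
    intro N η hη
    have hlim : ∀ᶠ k in (hyperfilter ℕ : Filter ℕ), ∀ l ∈ Φ N,
        translateDefect l (Φ (K k)) * (C * (C * Ch)) ≤ η / (‖ι 1‖ + 1) := by
      rw [Filter.eventually_all_finset]
      intro l _
      have h0 : Tendsto (fun k => translateDefect l (Φ (K k)) * (C * (C * Ch)))
          (hyperfilter ℕ : Filter ℕ) (𝓝 0) := by
        simpa using ((hΦ.tendsto_defect l).comp hK).mul_const (C * (C * Ch))
      exact h0.eventually (eventually_le_nhds (by positivity))
    filter_upwards [hlim] with k hk w
    have hsub : T N k w - finAvg 𝕜 (Φ (K k)) (fun m => B N k (w, m)) = finAvg 𝕜 (Φ N) fun l =>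
        finAvg 𝕜 (Φ (K k)) (ψ k w l) - finAvg 𝕜 (Φ (K k)) fun m => ψ k w l (l + m) := by
      rw [finAvg_sub, hT, finAvg_comm (Φ (K k))]
    refine (hι.norm_map_le _).trans ?_
    rw [hsub]
    have h2 := norm_finAvg_le_of_le (𝕜 := 𝕜) (s := Φ N) (by positivity) fun l hl =>
      (norm_finAvg_sub_translate_le (𝕜 := 𝕜) (Φ (K k)) l (hψ k w l)).trans (hk l hl)
    refine (mul_le_mul_of_nonneg_right h2 (norm_nonneg _)).trans ?_
    rw [div_mul_eq_mul_div, div_le_iff₀ (by positivity)]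
    nlinarith [norm_nonneg (ι 1)]
  intro ε hε
  obtain ⟨M, hM⟩ := hB (ε / 9) (by positivity)
  refine ⟨M, fun N hN N' hN' => ?_⟩
  have hη : 0 < Real.sqrt (ε / 9) := Real.sqrt_pos.2 (by positivity)
  filter_upwards [hM N hN N' hN', hclose N _ hη, hclose N' _ hη] with k hk hk1 hk2
  have hsplit : (fun w => ι (T N k w) - ι (T N' k w)) = fun w =>
      ι (T N k w - finAvg 𝕜 (Φ (K k)) fun m => B N k (w, m)) +
      ι ((finAvg 𝕜 (Φ (K k)) fun m => B N' k (w, m)) - T N' k w) +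
      ι (finAvg 𝕜 (Φ (K k)) fun m => B N k (w, m) - B N' k (w, m)) := by
    funext w
    rw [finAvg_sub, ← map_sub, ← map_add, ← map_add]
    congr 1
    abel
  have hsq : ∀ x : ℝ, 0 ≤ x → x ≤ Real.sqrt (ε / 9) → x ^ 2 ≤ ε / 9 := fun x hx0 hx =>
    (pow_le_pow_left₀ hx0 hx 2).trans (Real.sq_sqrt (by positivity)).le
  have b1 : meanSq (S k) (fun w => ι (T N k w - finAvg 𝕜 (Φ (K k)) fun m => B N k (w, m))) ≤
      ε / 9 := finAvg_le_of_le (by positivity) fun w _ => hsq _ (norm_nonneg _) (hk1 w)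
  have b2 : meanSq (S k) (fun w => ι ((finAvg 𝕜 (Φ (K k)) fun m => B N' k (w, m)) - T N' k w)) ≤
      ε / 9 := finAvg_le_of_le (by positivity) fun w _ => hsq _ (norm_nonneg _) (by
        simpa only [map_sub, norm_sub_rev] using hk2 w)
  have b3 : meanSq (S k) (fun w => ι (finAvg 𝕜 (Φ (K k)) fun m => B N k (w, m) - B N' k (w, m))) ≤
      ε / 9 := by
    refine le_trans ?_ hk
    rw [meanSq, meanSq, finAvg_product]
    refine finAvg_mono fun w _ => ?_
    rw [map_finAvg]
    refine (norm_sq_finAvg_le _ _).trans (le_of_eq ?_)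
    simp only [map_sub]
  change meanSq (S k) (fun w => ι (T N k w) - ι (T N' k w)) ≤ ε
  rw [hsplit]
  refine (meanSq_add_add_le _ _ _ _).trans ?_
  linarith

/-- Adding one family `g₀` to a system: if the reduced system is convergent, so are the averages
with `g₀` applied to a single factor.

The factor is split into a part with convergent averages and a part nearly orthogonal to all
such. If the averages `h` of the second part did not become small, the element dual to `h` would
have convergent averages and correlate with that part. -/
theorem isAsympCauchy_weightedAvg (hι : IsInvariantRepr 𝕜 G ι) (hΦ : IsFinsetFoelner Φ)
    (hev : ∀ n m g, ev n (τ m g) = ev (n + m) g) {W : Type} {R : Set (ℕ → W → Γ)}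
    {g₀ : ℕ → W → Γ} (h1 : 1 ∈ R)
    (hR : IsConvergentSystem ev Φ ι (W × V) (reducedSystem τ g₀ R))
    {J : Type} [Fintype J] {g : J → ℕ → W → Γ} (hg : ∀ j, g j ∈ R) {f : J → ℕ → W → A}
    (hf : ∀ j, IsUnifBounded fun t : ℕ × W => f j t.1 t.2) {F : ℕ → W → A}
    (hF : IsUnifBounded fun t : ℕ × W => F t.1 t.2) (S : ℕ → Finset W) :
    IsAsympCauchy S fun N k w => ι (weightedAvg 𝕜 ev (Φ N)
      (fun n => ∏ j, ev n (g j k w) • f j k w) (g₀ k w) (F k w)) := by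
  classical
  set P : ℕ → W → V → A := fun k w n => ∏ j, ev n (g j k w) • f j k w with hP
  obtain ⟨C, hC0, hC⟩ : ∃ C > 0, ∀ k w n, ‖P k w n‖ ≤ C := by
    have : IsUnifBounded fun t : ℕ × W × V => P t.1 t.2.1 t.2.2 :=
      IsUnifBounded.prod _ fun j => by
        obtain ⟨C, hC⟩ := hf j
        exact ⟨C, fun t => by rw [hι.norm_smul]; exact hC (t.1, t.2.1)⟩
    obtain ⟨C, hC0, hC⟩ := this.exists_pos
    exact ⟨C, hC0, fun k w n => hC (k, w, n)⟩
  let T : ℕ → (ℕ → W → A) → ℕ → W → A := fun N b k w =>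
    weightedAvg 𝕜 ev (Φ N) (P k w) (g₀ k w) (b k w)
  -- the bounded families whose averages are asymptotically Cauchy
  let K : Submodule 𝕜 (ℕ → W → A) :=
    { carrier := {b | IsUnifBounded (fun t : ℕ × W => b t.1 t.2) ∧
        IsAsympCauchy S fun N k w => ι (T N b k w)}
      zero_mem' := by
        refine ⟨⟨0, fun t => by simp⟩, fun ε hε => ⟨0, fun N _ N' _ => .of_forall fun k => ?_⟩⟩
        have h0 : ∀ N w, T N 0 k w = 0 := fun N w => by
          simp [T, weightedAvg, finAvg]
        simpa [h0, meanSq, finAvg] using hε.le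
      add_mem' := by
        rintro a b ⟨⟨Ca, hCa⟩, ha⟩ ⟨⟨Cb, hCb⟩, hb⟩
        refine ⟨⟨Ca + Cb, fun t => (norm_add_le _ _).trans (add_le_add (hCa t) (hCb t))⟩,
          fun ε hε => ?_⟩
        obtain ⟨M, hM⟩ := ha (ε / 6) (by positivity)
        obtain ⟨M', hM'⟩ := hb (ε / 6) (by positivity)
        refine ⟨max M M', fun N hN N' hN' => ?_⟩
        filter_upwards [hM N (le_of_max_le_left hN) N' (le_of_max_le_left hN'),
          hM' N (le_of_max_le_right hN) N' (le_of_max_le_right hN')] with k hk hk'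
        have e1 : (fun w => ι (T N (a + b) k w) - ι (T N' (a + b) k w)) = fun w =>
            (ι (T N a k w) - ι (T N' a k w)) + (ι (T N b k w) - ι (T N' b k w)) + 0 := by
          funext w
          simp only [T, Pi.add_apply, weightedAvg_add, map_add]
          abel
        rw [e1]
        refine (meanSq_add_add_le _ _ _ _).trans ?_
        have h0 : meanSq (S k) (fun _ : W => (0 : H)) = 0 := by simp [meanSq, finAvg]
        rw [h0]
        linarith
      smul_mem' := by
        rintro c b ⟨⟨Cb, hCb⟩, hb⟩
        refine ⟨⟨‖c‖ * Cb, fun t => (norm_smul_le c (b t.1 t.2)).trans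
          (mul_le_mul_of_nonneg_left (hCb t) (norm_nonneg _))⟩, fun ε hε => ?_⟩
        obtain ⟨M, hM⟩ := hb (ε / (‖c‖ ^ 2 + 1)) (by positivity)
        refine ⟨M, fun N hN N' hN' => ?_⟩
        filter_upwards [hM N hN N' hN'] with k hk
        have e1 : meanSq (S k) (fun w => ι (T N (c • b) k w) - ι (T N' (c • b) k w)) =
            ‖c‖ ^ 2 * meanSq (S k) (fun w => ι (T N b k w) - ι (T N' b k w)) := by
          rw [meanSq, meanSq, ← smul_eq_mul, ← finAvg_smul]
          simp only [T, Pi.smul_apply, weightedAvg_smul, map_smul, ← smul_sub, norm_smul, mul_pow,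
            smul_eq_mul]
        rw [e1]
        rw [le_div_iff₀ (by positivity)] at hk
        nlinarith [meanSq_nonneg (S k) fun w => ι (T N b k w) - ι (T N' b k w)] }
  intro ε hε
  obtain ⟨CF, hCF0, hCF⟩ := hF.exists_pos
  obtain ⟨b, hb, horth⟩ := exists_almost_orthogonal ι S K (F := F) (C := CF * ‖ι 1‖)
    (fun k w => (hι.norm_map_le _).trans
      (mul_le_mul_of_nonneg_right (hCF (k, w)) (norm_nonneg _)))
    (δ := ε / (9 * C ^ 2)) (by positivity)
  obtain ⟨Cb, hCb0, hCb⟩ := hb.1.exists_pos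
  set e : ℕ → W → A := fun k w => F k w - b k w with he
  have hCe : ∀ k w, ‖e k w‖ ≤ CF + Cb := fun k w =>
    (norm_sub_le _ _).trans (add_le_add (hCF (k, w)) (hCb (k, w)))
  -- the averages of the nearly orthogonal part are eventually small
  obtain ⟨M, hM⟩ : ∃ M, ∀ N ≥ M, ∀ᶠ k in (hyperfilter ℕ : Filter ℕ),
      meanSq (S k) (fun w => ι (T N e k w)) ≤ ε / 9 := by
    by_contra! hcon
    obtain ⟨L, hL, hbig⟩ := exists_tendsto_of_frequently hcon
    let h : ℕ → W → A := fun k w => T (L k) e k w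
    have hh : ∀ k w, ‖h k w‖ ≤ C * (CF + Cb) := fun k w =>
      (norm_weightedAvg_le hι hC0.le (hC k w) _).trans
        (mul_le_mul_of_nonneg_left (hCe k w) hC0.le)
    let σ : ℕ → W → A := fun k w =>
      dualAvg 𝕜 ev (Φ (L k)) (P k w) (g₀ k w) (h k w)
    have hσ : σ ∈ K := by
      refine ⟨⟨C * (C * (CF + Cb)), fun t => (norm_dualAvg_le hι hC0.le (hC t.1 t.2) _).trans
        (mul_le_mul_of_nonneg_left (hh _ _) hC0.le)⟩, ?_⟩
      exact isAsympCauchy_dualAvg hι hΦ hev h1 hR hg hf ⟨C * (CF + Cb), fun t => hh t.1 t.2⟩ hL S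
    -- the scalar `C⁻²` optimises the near orthogonality of `e` to the multiples of `σ`
    have hscaled := horth _ (K.smul_mem (((C ^ 2)⁻¹ : ℝ) : 𝕜) hσ)
    obtain ⟨k, hk, hkbig⟩ := (hscaled.and hbig).exists
    have hcorr : finAvg ℝ (S k) (fun w => RCLike.re (inner 𝕜 (ι (e k w))
        (ι (((((C ^ 2)⁻¹ : ℝ) : 𝕜) • σ) k w)))) = (C ^ 2)⁻¹ * meanSq (S k) (fun w => ι (h k w)) := by
      rw [meanSq, ← smul_eq_mul, ← finAvg_smul]
      congr 1
      funext w
      rw [Pi.smul_apply, Pi.smul_apply, map_smul, inner_smul_right, RCLike.re_ofReal_mul,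
        re_inner_dualAvg hι, ← inner_self_eq_norm_sq (𝕜 := 𝕜), smul_eq_mul]
    have hsize : meanSq (S k) (fun w => ι (((((C ^ 2)⁻¹ : ℝ) : 𝕜) • σ) k w)) ≤
        (C ^ 2)⁻¹ * meanSq (S k) (fun w => ι (h k w)) := by
      rw [meanSq, meanSq, ← smul_eq_mul, ← finAvg_smul]
      refine finAvg_mono fun w _ => ?_
      have hn : ‖ι (σ k w)‖ ^ 2 ≤ C ^ 2 * ‖ι (h k w)‖ ^ 2 := by
        rw [← mul_pow]
        exact pow_le_pow_left₀ (norm_nonneg _) (norm_map_dualAvg_le hι hC0.le (hC k w) _) 2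
      rw [Pi.smul_apply, Pi.smul_apply, map_smul, norm_smul, RCLike.norm_ofReal,
        abs_of_pos (by positivity), mul_pow, smul_eq_mul]
      calc ((C ^ 2)⁻¹) ^ 2 * ‖ι (σ k w)‖ ^ 2
          ≤ ((C ^ 2)⁻¹) ^ 2 * (C ^ 2 * ‖ι (h k w)‖ ^ 2) :=
            mul_le_mul_of_nonneg_left hn (by positivity)
        _ = (C ^ 2)⁻¹ * ‖ι (h k w)‖ ^ 2 := by field_simp
    have hk' : 2 * finAvg ℝ (S k) (fun w => RCLike.re (inner 𝕜 (ι (e k w))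
        (ι (((((C ^ 2)⁻¹ : ℝ) : 𝕜) • σ) k w)))) ≤ ε / (9 * C ^ 2) +
        meanSq (S k) (fun w => ι (((((C ^ 2)⁻¹ : ℝ) : 𝕜) • σ) k w)) := hk
    rw [hcorr] at hk'
    have h3 : (C ^ 2)⁻¹ * meanSq (S k) (fun w => ι (h k w)) ≤ ε / (9 * C ^ 2) := by linarith
    rw [inv_mul_le_iff₀ (by positivity)] at h3
    have h4 : C ^ 2 * (ε / (9 * C ^ 2)) = ε / 9 := by field_simp
    have h5 : ε / 9 < meanSq (S k) (fun w => ι (h k w)) := hkbig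
    linarith
  obtain ⟨M', hM'⟩ := hb.2 (ε / 9) (by positivity)
  refine ⟨max M M', fun N hN N' hN' => ?_⟩
  filter_upwards [hM' N (le_of_max_le_right hN) N' (le_of_max_le_right hN'),
    hM N (le_of_max_le_left hN), hM N' (le_of_max_le_left hN')] with k hk hk1 hk2
  have hT : ∀ N w, T N F k w = T N b k w + T N e k w := fun N w => by
    simp only [T, he, ← weightedAvg_add, add_sub_cancel]
  have hsplit : (fun w => ι (T N F k w) - ι (T N' F k w)) = fun w =>
      (ι (T N b k w) - ι (T N' b k w)) + ι (T N e k w) + -ι (T N' e k w) := by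
    funext w
    rw [hT, hT, map_add, map_add]
    abel
  change meanSq (S k) (fun w => ι (T N F k w) - ι (T N' F k w)) ≤ ε
  rw [hsplit]
  refine (meanSq_add_add_le _ _ _ _).trans ?_
  have hneg : meanSq (S k) (fun w => -ι (T N' e k w)) = meanSq (S k) fun w => ι (T N' e k w) := by
    simp only [meanSq, norm_neg]
  rw [hneg]
  linarith

/-- Convergence of systems is stable under reductions. -/
theorem isReductionStable_isConvergentSystem (hι : IsInvariantRepr 𝕜 G ι)
    (hΦ : IsFinsetFoelner Φ) (hev : ∀ n m g, ev n (τ m g) = ev (n + m) g) :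
    IsReductionStable τ (IsConvergentSystem ev Φ ι) where
  mono h hS J _ g hg := hS J g fun j => h (hg j)
  finitary {W S} h J _ g hg :=
    h (Set.range g) (by rintro _ ⟨j, rfl⟩; exact hg j) (Set.finite_range g) J g
      fun j => ⟨j, rfl⟩
  one W J _ g hg f _ S ε hε := by
    obtain ⟨M, hM⟩ := eventually_atTop.1 hΦ.nonempty
    refine ⟨M, fun N hN N' hN' => .of_forall fun k => ?_⟩
    have hconst : ∀ N ≥ M, ∀ w, multiAvg 𝕜 ev (Φ N) (fun j => g j k w) (fun j => f j k w) =
        ∏ j, f j k w := by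
      intro N hN w
      have : ∀ j, g j k w = 1 := fun j => by rw [Set.mem_singleton_iff.1 (hg j)]; rfl
      simp only [multiAvg, this, map_one, one_smul]
      exact finAvg_const (hM N hN) _
    simpa [hconst N hN, hconst N' hN', meanSq, finAvg] using hε.le
  step {W R} g₀ h1 hR J _ g hg f hf S := by
    classical
    -- the factors on which `g₀` acts are collected into a single one
    have h := isAsympCauchy_weightedAvg hι hΦ hev h1 hR (J := {j // ¬ g j = g₀})
      (g := fun j => g j) (fun j => (hg j).resolve_left j.2) (f := fun j => f j)
      (fun j => hf j) (F := fun k w => ∏ j : {j // g j = g₀}, f j k w)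
      (IsUnifBounded.prod _ fun j : {j // g j = g₀} => hf j) S
    convert h using 5 with N k w
    rw [multiAvg, weightedAvg]
    congr 1
    funext n
    rw [← Fintype.prod_subtype_mul_prod_subtype (fun j => g j = g₀), mul_comm, Finset.smul_prod']
    congr 1
    refine Finset.prod_congr rfl fun j _ => ?_
    rw [j.2]

end MultipleAverages

/-! ### Convergence for polynomial sequences in a nilpotent group -/

/-- Multiple averages along polynomial sequences in a nilpotent group form a Cauchy sequence. -/
theorem cauchySeq_polynomialSequences {𝕜 G A H : Type*} [RCLike 𝕜] [NormedCommRing A]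
    [NormedAlgebra 𝕜 A] [StarRing A] [SeminormedAddCommGroup H] [InnerProductSpace 𝕜 H] [Group G]
    [Group.IsNilpotent G] [MulSemiringAction G A] [SMulCommClass G 𝕜 A] {ι : A →ₗ[𝕜] H}
    (hι : IsInvariantRepr 𝕜 G ι) {V : Type} [AddCommGroup V] {Φ : ℕ → Finset V}
    (hΦ : IsFinsetFoelner Φ) {J : Type} [Fintype J] {e : ℕ} {g : J → V → G}
    (hg : ∀ j, g j ∈ polynomialSequences V G e) (f : J → A) :
    CauchySeq fun N => ι (finAvg 𝕜 (Φ N) fun n => ∏ j, g j n • f j) := by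
  let ev : V → polynomialSequences V G e →* G := fun n =>
    (Pi.evalMonoidHom (fun _ : V => G) n).comp (polynomialSequences V G e).subtype
  have hgood := (isReductionStable_isConvergentSystem (ev := ev) (τ := polynomialShift V G e)
    (Φ := Φ) hι hΦ fun n m g => rfl).good_familiesIn (unipotent_polynomialShift e) Unit
  have h := hgood J (fun j _ _ => ⟨g j, hg j⟩) (fun j _ _ => Subgroup.mem_top _)
    (fun j _ _ => f j) (fun j => ⟨‖f j‖, fun _ => le_rfl⟩) (fun _ => {()})
  rw [Metric.cauchySeq_iff]
  intro ε hε
  obtain ⟨M, hM⟩ := h ((ε / 2) ^ 2) (by positivity)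
  refine ⟨M, fun N hN N' hN' => ?_⟩
  obtain ⟨k, hk⟩ := (hM N hN N' hN').exists
  simp only [meanSq, finAvg, Finset.card_singleton, Nat.cast_one, inv_one, Finset.sum_singleton,
    one_smul] at hk
  have h2 := abs_le_of_sq_le_sq hk (by positivity)
  rw [dist_eq_norm]
  exact (le_abs_self _).trans_lt (h2.trans_lt (by linarith))

/-- The same for a commutative algebra of operators on a Hilbert space, normalized by a unitary
representation `U` of `G`, applied to a `U`-invariant vector `v`. -/
theorem cauchySeq_operators {𝕜 G H : Type*} [RCLike 𝕜] [NormedAddCommGroup H]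
    [InnerProductSpace 𝕜 H] [CompleteSpace H] [Group G] [Group.IsNilpotent G]
    (U : G →* (H →L[𝕜] H)) (hU : ∀ g x, ‖U g x‖ = ‖x‖) (𝓐 : StarSubalgebra 𝕜 (H →L[𝕜] H))
    (hcomm : ∀ a ∈ 𝓐, ∀ b ∈ 𝓐, a * b = b * a) (hnorm : ∀ g, ∀ a ∈ 𝓐, U g * a * U g⁻¹ ∈ 𝓐)
    {v : H} (hv : ∀ g, U g v = v) {V : Type} [AddCommGroup V] {Φ : ℕ → Finset V}
    (hΦ : IsFinsetFoelner Φ) {r e : ℕ} {g : Fin r → V → G}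
    (hg : ∀ j, g j ∈ polynomialSequences V G e) {T : Fin r → H →L[𝕜] H} (hT : ∀ j, T j ∈ 𝓐) :
    CauchySeq fun N => (finAvg 𝕜 (Φ N) fun n =>
      (List.ofFn fun j => U (g j n) * T j * U (g j n)⁻¹).prod) v := by
  have hUinv : ∀ γ, U γ⁻¹ * U γ = 1 := fun γ => by rw [← map_mul, inv_mul_cancel, map_one]
  have hUinv' : ∀ γ, U γ * U γ⁻¹ = 1 := fun γ => by rw [← map_mul, mul_inv_cancel, map_one]
  have hstar : ∀ γ, star (U γ) = U γ⁻¹ := fun γ => by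
    have h1 : star (U γ) * U γ = 1 :=
      (ContinuousLinearMap.norm_map_iff_adjoint_comp_self (U γ)).1 (hU γ)
    calc star (U γ) = star (U γ) * U γ * U γ⁻¹ := by rw [mul_assoc, hUinv', mul_one]
      _ = U γ⁻¹ := by rw [h1, one_mul]
  have hUle : ∀ γ, ‖U γ‖ ≤ 1 := fun γ =>
    ContinuousLinearMap.opNorm_le_bound _ zero_le_one fun x => by rw [hU, one_mul]
  have hconj : ∀ γ (a : H →L[𝕜] H), ‖U γ * a * U γ⁻¹‖ ≤ ‖a‖ := fun γ a => by
    calc ‖U γ * a * U γ⁻¹‖ ≤ ‖U γ‖ * ‖a‖ * ‖U γ⁻¹‖ :=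
          (norm_mul_le _ _).trans (mul_le_mul_of_nonneg_right (norm_mul_le _ _) (norm_nonneg _))
      _ ≤ 1 * ‖a‖ * 1 := by gcongr <;> exact hUle _
      _ = ‖a‖ := by ring
  let _ : NormedCommRing 𝓐 :=
    { (inferInstance : NormedRing 𝓐) with
      mul_comm := fun a b => Subtype.ext (hcomm a a.2 b b.2) }
  let _ : MulSemiringAction G 𝓐 :=
    { smul := fun γ a => ⟨U γ * a * U γ⁻¹, hnorm γ a a.2⟩
      one_smul := fun a => Subtype.ext (by
        change U 1 * (a : H →L[𝕜] H) * U 1⁻¹ = a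
        rw [inv_one, map_one, one_mul, mul_one])
      mul_smul := fun γ δ a => Subtype.ext (by
        change U (γ * δ) * (a : H →L[𝕜] H) * U (γ * δ)⁻¹ = U γ * (U δ * a * U δ⁻¹) * U γ⁻¹
        rw [mul_inv_rev, map_mul, map_mul]
        simp only [mul_assoc])
      smul_zero := fun γ => Subtype.ext (by
        change U γ * (0 : H →L[𝕜] H) * U γ⁻¹ = 0
        rw [mul_zero, zero_mul])
      smul_add := fun γ a b => Subtype.ext (by
        change U γ * ((a : H →L[𝕜] H) + b) * U γ⁻¹ = U γ * a * U γ⁻¹ + U γ * b * U γ⁻¹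
        rw [mul_add, add_mul])
      smul_one := fun γ => Subtype.ext (by
        change U γ * (1 : H →L[𝕜] H) * U γ⁻¹ = 1
        rw [mul_one, hUinv'])
      smul_mul := fun γ a b => Subtype.ext (by
        change U γ * ((a : H →L[𝕜] H) * b) * U γ⁻¹ = (U γ * a * U γ⁻¹) * (U γ * b * U γ⁻¹)
        rw [mul_assoc (U γ * (a : H →L[𝕜] H)), ← mul_assoc (U γ⁻¹), ← mul_assoc (U γ⁻¹), hUinv,
          one_mul]
        simp only [mul_assoc]) }
  have hsmul : ∀ (γ : G) (a : 𝓐), ((γ • a : 𝓐) : H →L[𝕜] H) = U γ * a * U γ⁻¹ := fun _ _ => rfl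
  have : SMulCommClass G 𝕜 𝓐 := ⟨fun γ c a => Subtype.ext (by
    change U γ * (c • (a : H →L[𝕜] H)) * U γ⁻¹ = c • (U γ * a * U γ⁻¹)
    rw [mul_smul_comm, smul_mul_assoc])⟩
  let ι : 𝓐 →ₗ[𝕜] H :=
    { toFun := fun a => (a : H →L[𝕜] H) v
      map_add' := fun _ _ => rfl
      map_smul' := fun _ _ => rfl }
  have hιa : ∀ a : 𝓐, ι a = (a : H →L[𝕜] H) v := fun _ => rfl
  have hι : IsInvariantRepr 𝕜 G ι :=
    { norm_map_mul_le := fun a b => (a : H →L[𝕜] H).le_opNorm _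
      inner_map_mul := fun a b c =>
        (ContinuousLinearMap.adjoint_inner_right (a : H →L[𝕜] H) _ _).symm
      inner_map_smul := fun γ a b => by
        have h1 : ∀ a : 𝓐, ι (γ • a) = U γ (ι a) := fun a => by
          change U γ ((a : H →L[𝕜] H) (U γ⁻¹ v)) = _
          rw [hv]; rfl
        rw [h1, h1]
        exact LinearIsometry.inner_map_map ⟨(U γ : H →ₗ[𝕜] H), hU γ⟩ _ _
      norm_smul := fun γ a => by
        refine le_antisymm (hconj γ a) ?_
        have h1 := hconj γ⁻¹ ((γ • a : 𝓐) : H →L[𝕜] H)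
        have h2 : U γ⁻¹ * ((γ • a : 𝓐) : H →L[𝕜] H) * U γ⁻¹⁻¹ = a := by
          rw [← hsmul, inv_smul_smul]
        rw [h2] at h1
        exact h1
      star_smul := fun γ a => Subtype.ext (by
        change star (U γ * (a : H →L[𝕜] H) * U γ⁻¹) = U γ * star (a : H →L[𝕜] H) * U γ⁻¹
        rw [star_mul, star_mul, hstar, hstar, inv_inv, mul_assoc])
      norm_star := fun a => norm_star (a : H →L[𝕜] H) }
  have h := cauchySeq_polynomialSequences hι hΦ hg fun j => ⟨T j, hT j⟩
  convert h using 2 with N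
  rw [hιa]
  congr 1
  have hcoe : ∀ (s : Finset V) (F : V → 𝓐), ((finAvg 𝕜 s F : 𝓐) : H →L[𝕜] H) =
      finAvg 𝕜 s fun n => (F n : H →L[𝕜] H) := fun s F =>
    map_finAvg 𝓐.toSubalgebra.val.toLinearMap s F
  rw [hcoe]
  congr 1
  funext n
  rw [← List.prod_ofFn]
  change _ = 𝓐.subtype _
  rw [map_list_prod, List.map_ofFn]
  rfl

/-! ### Multiplication operators and Koopman operators on `L²` -/

section LTwo

variable {X 𝕜 : Type*} [MeasurableSpace X] {μ : Measure X} [RCLike 𝕜]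

/-- The operator `T` on `L²` is multiplication by the function `f`. -/
def IsMulOperator (f : X → 𝕜) (T : Lp 𝕜 2 μ →L[𝕜] Lp 𝕜 2 μ) : Prop :=
  ∀ x : Lp 𝕜 2 μ, T x =ᵐ[μ] fun t => f t * x t

namespace IsMulOperator

variable {f g : X → 𝕜} {S T : Lp 𝕜 2 μ →L[𝕜] Lp 𝕜 2 μ}

theorem one : IsMulOperator (fun _ : X => (1 : 𝕜)) (1 : Lp 𝕜 2 μ →L[𝕜] Lp 𝕜 2 μ) :=
  fun x => .of_forall fun t => by simp

theorem mul (hS : IsMulOperator f S) (hT : IsMulOperator g T) :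
    IsMulOperator (fun t => f t * g t) (S * T) := by
  intro x
  filter_upwards [hS (T x), hT x] with t h1 h2
  rw [mul_assoc, ← h2, ← h1]
  rfl

theorem add (hS : IsMulOperator f S) (hT : IsMulOperator g T) :
    IsMulOperator (fun t => f t + g t) (S + T) := by
  intro x
  filter_upwards [hS x, hT x, Lp.coeFn_add (S x) (T x)] with t h1 h2 h3
  rw [add_mul, ← h1, ← h2]
  exact h3

theorem smul (c : 𝕜) (hT : IsMulOperator f T) : IsMulOperator (fun t => c * f t) (c • T) := by
  intro x
  filter_upwards [hT x, Lp.coeFn_smul c (T x)] with t h1 h2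
  rw [mul_assoc, ← h1]
  exact h2

theorem zero : IsMulOperator (fun _ : X => (0 : 𝕜)) (0 : Lp 𝕜 2 μ →L[𝕜] Lp 𝕜 2 μ) := by
  intro x
  filter_upwards [Lp.coeFn_zero 𝕜 2 μ] with t h
  rw [zero_mul]
  exact h

theorem sum {α : Type*} (s : Finset α) {F : α → X → 𝕜} {T : α → Lp 𝕜 2 μ →L[𝕜] Lp 𝕜 2 μ}
    (h : ∀ i, IsMulOperator (F i) (T i)) :
    IsMulOperator (fun t => ∑ i ∈ s, F i t) (∑ i ∈ s, T i) := by
  classical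
  induction s using Finset.induction_on with
  | empty => simpa using zero
  | insert a s ha ih => simpa only [Finset.sum_insert ha] using (h a).add ih

theorem prod_ofFn {r : ℕ} {F : Fin r → X → 𝕜} {T : Fin r → Lp 𝕜 2 μ →L[𝕜] Lp 𝕜 2 μ}
    (h : ∀ j, IsMulOperator (F j) (T j)) :
    IsMulOperator (fun t => ∏ j, F j t) (List.ofFn T).prod := by
  induction r with
  | zero => simpa using one
  | succ r ih =>
    simp only [List.ofFn_succ, List.prod_cons, Fin.prod_univ_succ]
    exact (h 0).mul (ih fun j => h j.succ)

theorem comm (hS : IsMulOperator f S) (hT : IsMulOperator g T) : S * T = T * S := by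
  ext1 x
  refine Lp.ext ?_
  filter_upwards [hS.mul hT x, hT.mul hS x] with t h1 h2
  rw [h1, h2, mul_comm (f t)]

theorem exists_of_memLp (hf : MemLp f ⊤ μ) :
    ∃ T : Lp 𝕜 2 μ →L[𝕜] Lp 𝕜 2 μ, IsMulOperator f T := by
  refine ⟨(ContinuousLinearMap.mul 𝕜 𝕜).holderL μ ⊤ 2 2 (hf.toLp f), fun x => ?_⟩
  filter_upwards [ContinuousLinearMap.coeFn_holder (r := 2) (ContinuousLinearMap.mul 𝕜 𝕜)
    (hf.toLp f) x, hf.coeFn_toLp] with t h1 h2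
  rw [← h2]
  exact h1

theorem star_eq (hS : IsMulOperator (fun t => star (f t)) S) (hT : IsMulOperator f T) :
    star T = S := by
  refine ((ContinuousLinearMap.eq_adjoint_iff S T).2 fun x y => ?_).symm
  rw [L2.inner_def, L2.inner_def]
  refine integral_congr_ae ?_
  filter_upwards [hS x, hT y] with t h1 h2
  rw [h1, h2, RCLike.inner_apply, RCLike.inner_apply]
  simp only [map_mul, RCLike.star_def, RCLike.conj_conj]
  ring

end IsMulOperator

variable (𝕜 μ) in
/-- The algebra of multiplication operators by essentially bounded functions. -/
def mulOperators : StarSubalgebra 𝕜 (Lp 𝕜 2 μ →L[𝕜] Lp 𝕜 2 μ) where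
  carrier := {T | ∃ f, MemLp f ⊤ μ ∧ IsMulOperator f T}
  mul_mem' := by
    rintro S T ⟨f, hf, hS⟩ ⟨g, hg, hT⟩
    exact ⟨_, hg.mul hf, hS.mul hT⟩
  add_mem' := by
    rintro S T ⟨f, hf, hS⟩ ⟨g, hg, hT⟩
    exact ⟨_, hf.add hg, hS.add hT⟩
  algebraMap_mem' c := by
    refine ⟨fun _ => c, memLp_top_const c, ?_⟩
    rw [Algebra.algebraMap_eq_smul_one]
    simpa using IsMulOperator.one.smul c
  star_mem' := by
    rintro T ⟨f, hf, hT⟩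
    obtain ⟨S, hS⟩ := IsMulOperator.exists_of_memLp hf.star
    rw [IsMulOperator.star_eq hS hT]
    exact ⟨_, hf.star, hS⟩

variable {G : Type*} [Group G] {ρ : G → X → X}

/-- The Koopman representation of `G` on `L²`. The inverse turns the right action
`f ↦ f ∘ ρ g` on functions into a left action. -/
noncomputable def koopman (𝕜 : Type*) [RCLike 𝕜] (hρ : IsMeasurePreservingAction ρ μ) :
    G →* (Lp 𝕜 2 μ →L[𝕜] Lp 𝕜 2 μ) where
  toFun g := (Lp.compMeasurePreservingₗᵢ 𝕜 (ρ g⁻¹)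
    (hρ.measurePreserving g⁻¹)).toContinuousLinearMap
  map_one' := by
    ext1 x
    refine Lp.ext ?_
    refine (Lp.coeFn_compMeasurePreserving x (hρ.measurePreserving 1⁻¹)).trans ?_
    filter_upwards [hρ.one_ae] with t ht
    rw [Function.comp_apply, inv_one, ht]
    rfl
  map_mul' g h := by
    ext1 x
    refine Lp.ext ?_
    refine (Lp.coeFn_compMeasurePreserving x (hρ.measurePreserving (g * h)⁻¹)).trans ?_
    let y := Lp.compMeasurePreserving (ρ h⁻¹) (hρ.measurePreserving h⁻¹) x
    have h1 : (Lp.compMeasurePreserving (ρ g⁻¹) (hρ.measurePreserving g⁻¹) y : X → 𝕜) =ᵐ[μ]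
        y ∘ ρ g⁻¹ := Lp.coeFn_compMeasurePreserving y _
    have h2 : (y : X → 𝕜) ∘ ρ g⁻¹ =ᵐ[μ] (x ∘ ρ h⁻¹) ∘ ρ g⁻¹ :=
      (hρ.measurePreserving g⁻¹).quasiMeasurePreserving.ae_eq_comp
        (Lp.coeFn_compMeasurePreserving x _)
    refine EventuallyEq.trans ?_ (h1.trans h2).symm
    filter_upwards [hρ.mul_ae h⁻¹ g⁻¹] with t ht
    rw [Function.comp_apply, mul_inv_rev, ht]
    rfl

theorem coeFn_koopman (hρ : IsMeasurePreservingAction ρ μ) (g : G) (x : Lp 𝕜 2 μ) :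
    koopman 𝕜 hρ g x =ᵐ[μ] fun t => x (ρ g⁻¹ t) :=
  Lp.coeFn_compMeasurePreserving x (hρ.measurePreserving g⁻¹)

theorem norm_koopman (hρ : IsMeasurePreservingAction ρ μ) (g : G) (x : Lp 𝕜 2 μ) :
    ‖koopman 𝕜 hρ g x‖ = ‖x‖ :=
  Lp.norm_compMeasurePreserving x (hρ.measurePreserving g⁻¹)

theorem IsMulOperator.conj_koopman (hρ : IsMeasurePreservingAction ρ μ) (g : G) {f : X → 𝕜}
    {T : Lp 𝕜 2 μ →L[𝕜] Lp 𝕜 2 μ} (hT : IsMulOperator f T) :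
    IsMulOperator (fun t => f (ρ g⁻¹ t)) (koopman 𝕜 hρ g * T * koopman 𝕜 hρ g⁻¹) := by
  intro x
  have hx : koopman 𝕜 hρ g (koopman 𝕜 hρ g⁻¹ x) = x := by
    change (koopman 𝕜 hρ g * koopman 𝕜 hρ g⁻¹) x = x
    rw [← map_mul, mul_inv_cancel, map_one]
    rfl
  have h1 := coeFn_koopman hρ g (koopman 𝕜 hρ g⁻¹ x)
  rw [hx] at h1
  have h2 := (hρ.measurePreserving g⁻¹).quasiMeasurePreserving.ae_eq_comp
    (hT (koopman 𝕜 hρ g⁻¹ x))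
  filter_upwards [coeFn_koopman hρ g (T (koopman 𝕜 hρ g⁻¹ x)), h1, h2] with t e1 e2 e3
  rw [e2]
  exact e1.trans e3

end LTwo

/-! ### The convergence theorem -/

open scoped Pointwise in
theorem IsAddFoelner.isFinsetFoelner {d : ℕ} {Φ : ℕ → Finset (Fin d → ℤ)}
    (hΦ : IsAddFoelner (Fin d → ℤ) Measure.count atTop fun N => (Φ N : Set (Fin d → ℤ))) :
    IsFinsetFoelner Φ where
  nonempty := by
    filter_upwards [hΦ.eventually_meas_ne_zero] with N hN
    rw [Measure.count_apply_finset] at hN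
    exact Finset.card_ne_zero.1 (by exact_mod_cast hN)
  tendsto_defect v := by
    classical
    have h := (ENNReal.tendsto_toReal ENNReal.zero_ne_top).comp
      (hΦ.tendsto_meas_vadd_symmDiff v)
    refine h.congr fun N => ?_
    have e1 : symmDiff (v +ᵥ (Φ N : Set (Fin d → ℤ))) (Φ N) =
        ((symmDiff ((Φ N).image (v + ·)) (Φ N) : Finset (Fin d → ℤ)) : Set (Fin d → ℤ)) := by
      rw [Finset.coe_symmDiff, Finset.coe_image]
      rfl
    rw [Function.comp_apply, e1, Measure.count_apply_finset, Measure.count_apply_finset,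
      ENNReal.toReal_div, ENNReal.toReal_natCast, ENNReal.toReal_natCast, translateDefect,
      div_eq_inv_mul]
    congr!

/-- Ordered products of powers with polynomial exponents are polynomial sequences. -/
theorem orderedZPowProd_mem_polynomialSequences {V G : Type*} [AddCommGroup V] [Group G] {l e : ℕ}
    (T : Fin l → G) {p : Fin l → V → ℤ} (hp : ∀ i, VanishingDiff e (p i)) :
    (fun u => orderedZPowProd T fun i => p i u) ∈ polynomialSequences V G e := by
  have h : (fun u => orderedZPowProd T fun i => p i u) =
      (List.ofFn fun i => fun u => T i ^ p i u).prod := by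
    funext u
    change _ = Pi.evalMonoidHom (fun _ : V => G) u (List.ofFn fun i => fun u => T i ^ p i u).prod
    rw [map_list_prod, List.map_ofFn]
    rfl
  rw [h]
  refine Subgroup.list_prod_mem _ fun g hg => ?_
  obtain ⟨i, rfl⟩ := (List.mem_ofFn' _ _).1 hg
  exact Subgroup.subset_closure ⟨T i, p i, hp i, rfl⟩

theorem theorem5p1 {X : Type*} [MeasurableSpace X] (μ : Measure X) [IsProbabilityMeasure μ]
    {G : Type*} [Group G] [Group.IsNilpotent G]
    (ρ : G → X → X) (hρ : IsMeasurePreservingAction ρ μ)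
    {𝕜 : Type*} [RCLike 𝕜] {d l r : ℕ}
    (T : Fin l → G)
    (f : Fin r → X → 𝕜) (hf : ∀ j, MemLp (f j) ⊤ μ)
    (p : Fin l → Fin r → (Fin d → ℤ) → ℤ) (hp : ∀ i j, IsIntValuedPolynomial (p i j))
    (Φ : ℕ → Finset (Fin d → ℤ))
    (hΦ : IsAddFoelner (Fin d → ℤ) Measure.count atTop fun N => (Φ N : Set (Fin d → ℤ))) :
    ∃ F : X → 𝕜, MemLp F 2 μ ∧
      Tendsto (fun N => eLpNorm (polynomialAverage ρ T p f (Φ N) - F) 2 μ) atTop (𝓝 0) := by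
  choose e he using fun i j => (hp i j).exists_vanishingDiff
  obtain ⟨D, hD⟩ : ∃ D, ∀ i j, VanishingDiff D (p i j) :=
    ⟨∑ i, ∑ j, e i j, fun i j => (he i j).mono
      ((Finset.single_le_sum (f := e i) (fun _ _ => Nat.zero_le _) (Finset.mem_univ j)).trans
        (Finset.single_le_sum (f := fun i => ∑ j, e i j) (fun _ _ => Nat.zero_le _)
          (Finset.mem_univ i)))⟩
  choose M hM using fun j => IsMulOperator.exists_of_memLp (hf j)
  let v : Lp 𝕜 2 μ := (memLp_const (1 : 𝕜)).toLp _
  have hv1 : v =ᵐ[μ] fun _ => 1 := MemLp.coeFn_toLp _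
  -- the inverse of the sequence matches the inverse in the Koopman representation
  let g : Fin r → (Fin d → ℤ) → G := fun j u => (orderedZPowProd T fun i => p i j u)⁻¹
  have hg : ∀ j, g j ∈ polynomialSequences (Fin d → ℤ) G D := fun j =>
    Subgroup.inv_mem _ (orderedZPowProd_mem_polynomialSequences T fun i => hD i j)
  have hcauchy := cauchySeq_operators (koopman 𝕜 hρ) (norm_koopman hρ) (mulOperators 𝕜 μ)
    (by rintro a ⟨f, -, ha⟩ b ⟨g, -, hb⟩; exact ha.comm hb)
    (by
      rintro g a ⟨f, hf, ha⟩
      exact ⟨_, hf.comp_measurePreserving (hρ.measurePreserving g⁻¹), ha.conj_koopman hρ g⟩)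
    (v := v)
    (by
      intro g
      refine Lp.ext ?_
      filter_upwards [coeFn_koopman hρ g v, hv1,
        (hρ.measurePreserving g⁻¹).quasiMeasurePreserving.ae_eq_comp hv1] with t h1 h2 h3
      rw [h1, h2]
      exact h3)
    hΦ.isFinsetFoelner hg (T := M) fun j => ⟨f j, hf j, hM j⟩
  obtain ⟨L, hL⟩ := cauchySeq_tendsto_of_complete hcauchy
  refine ⟨L, Lp.memLp L, ?_⟩
  rw [Lp.tendsto_Lp_iff_tendsto_eLpNorm'] at hL
  refine hL.congr fun N => eLpNorm_congr_ae (EventuallyEq.sub ?_ .rfl)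
  have hop : IsMulOperator (polynomialAverage ρ T p f (Φ N)) (finAvg 𝕜 (Φ N) fun n =>
      (List.ofFn fun j => koopman 𝕜 hρ (g j n) * M j * koopman 𝕜 hρ (g j n)⁻¹).prod) := by
    refine IsMulOperator.smul _ (IsMulOperator.sum _ fun u => IsMulOperator.prod_ofFn fun j => ?_)
    have h := (hM j).conj_koopman hρ (g j u)
    rw [show (g j u)⁻¹ = orderedZPowProd T fun i => p i j u from inv_inv _] at h ⊢
    exact h
  filter_upwards [hop v, hv1] with t h1 h2
  rw [h1, h2, mul_one]
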